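/- **Conventions.** Cardinals are identified with initial ordinals, and $+$, $\cdot$ and powers of ordinals denote ordinal arithmetic. For ordinals $\beta>1$ and $\gamma\ge 1$, $\log_\beta\gamma$ is the unique ordinal $\delta$ with $\gamma=\beta^{\delta}\cdot\zeta+\eta$, $1\le\zeta<\beta$, $\eta<\beta^{\delta}$. For a function $h$ from an ordinal $\lambda$ to the ordinals, $\sum h$ is the transfinite ordinal sum (partial sums are $0$ at $0$, add $h(\gamma)$ at the successor of $\gamma$, and are suprema at limits). For an ordinal $\alpha$ put $0\sim_\alpha 0$, and for $\beta,\gamma$ not both $0$ put $\beta\sim_\alpha\gamma$ iff $\beta<\gamma\cdot\aleph_\alpha$ and $\gamma<\beta\cdot\aleph_\alpha$; write $[\beta]_\alpha<[\gamma]_\alpha$ iff $\beta\not\sim_\alpha\gamma$ and $\beta<\gamma$. **Language.** Let $\mathbf P$ be a set of propositions. Formulas are $\phi::=p\mid\neg\phi\mid(\phi\wedge\phi)\mid\Box\phi\mid\boxplus\phi$ with $p\in\mathbf P$, where $\boxplus$ is a second modality. Degrees are $\deg p=0$, $\deg\neg\phi=\deg\phi$, $\deg(\phi\wedge\psi)=\max\{\deg\phi,\deg\psi\}$,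 $\deg\Box\phi=\deg\phi+1$, $\deg\boxplus\phi=\deg\phi+2$. **Models.** A Kripke model $\mathcal M=(S,R,V)$ consists of a non-empty set $S$, a relation $R\subseteq S\times S$ and $V:\mathbf P\to\mathcal P(S)$; its size is $|S|$. A pointed model $\mathcal M,s$ is *tree-like* if it is a tree with root $s$: every world is reachable from $s$ by finitely many (possibly zero) $R$-steps, $s$ has no $R$-predecessor, and no world has two distinct $R$-predecessors. Write $\kappa_s=|\{t:sRt\}|$ and $\lambda_s=|\{t:sRt,\ \exists u\ tRu\}|$. **Semantics.** Fix arbitrary bijections $f_s:\lambda_s\to\{t:sRt,\exists u\,tRu\}$ and $g_t:\kappa_t\to\{u:tRu\}$ for all worlds $s,t$. Atoms, $\neg$ and $\wedge$ are interpreted as usual. If $\kappa_s$ is infinite, $\mathcal M,s\vDash\Box\phi$ iff $|\{t:sRt,\ \mathcal M,t\vDash\phi\}|>|\{t:sRt,\ \mathcal M,t\nvDash\phi\}|$; if $\kappa_s$ is finite, $\mathcal M,s\vDash\Box\phi$ iff $\mathcal M,t\vDash\phi$ for all $t$ with $sRt$. For $\boxplus\phi$ and $\gamma<\lambda_s$ let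 $h(\gamma)=\kappa_{f_s(\gamma)}$, and let $h^{+}(\gamma)$ (resp. $h^-(\gamma)$) be the order type, in the well-order given by $g_{f_s(\gamma)}$, of the set of successors of $f_s(\gamma)$ at which $\phi$ holds (resp. fails). If $|\sum h|=\aleph_\zeta$ is infinite, $\mathcal M,s\vDash\boxplus\phi$ iff $[\sum h^+]_\zeta>[\sum h^-]_\zeta$; otherwise $\mathcal M,s\vDash\boxplus\phi$ iff $\mathcal M,u\vDash\phi$ for all $t,u$ with $sRt$, $tRu$. **Modal equivalence.** For $k\in\omega$ and ordinals $\alpha,\beta$, the pointed models $\mathcal M,s$ and $\mathcal N,w$ are $(k,\alpha,\beta)$-modal-equivalent if (i) $\mathcal M,s\vDash\phi\iff\mathcal N,w\vDash\phi$ for every formula $\phi$ with $\deg\phi\le k$, and (ii) for every formula $\phi$ with $\deg\phi<k$, either neither $s$ nor $w$ has a successor satisfying $\phi$, or both have one and $$\log_{\aleph_\alpha}|\{t:t\text{ is a successor of }s,\ \mathcal M,t\vDash\phi\}|=\log_{\aleph_\beta}|\{v:v\text{ is a successor of }w,\ \mathcal N,v\vDash\phi\}|.$$ **Theorem.** Assume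 that $\mathbf P$ is finite. Let $\mathcal M,s$ be a tree-like pointed model such that for every world $x$ the cardinal $|\{u:\exists t\ (xRt\wedge tRu)\}|$ is finite or regular. Let $k\in\omega$ and let $\alpha$ be an ordinal with $|\{t:sRt\}|\le\aleph_\alpha$. Then there exists $m\in\omega$ such that for every $n\in\omega$ with $n\ge m$ there exists a tree-like pointed model $\mathcal N_n,w$ of size smaller than $\aleph_\omega$ such that, for every choice of the bijections in the semantics of $\mathcal M$ and of $\mathcal N_n$, the pointed models $\mathcal M,s$ and $\mathcal N_n,w$ are $(k,\alpha,n)$-modal-equivalent. -/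

import Mathlib

open Cardinal Ordinal

universe u v

namespace TransfiniteModal

/-! ### Ordinal arithmetic -/

/-- The relation `β ∼_α γ` on ordinals. -/
def OrdSim (α β γ : Ordinal.{u}) : Prop :=
  (β = 0 ∧ γ = 0) ∨ ((0 < β ∨ 0 < γ) ∧ β < γ * ω_ α ∧ γ < β * ω_ α)

/-- The order `[β]_α < [γ]_α` of equivalence classes modulo `∼_α`, on representatives. -/
def ClassLT (α β γ : Ordinal.{u}) : Prop :=
  ¬ OrdSim α β γ ∧ β < γ

/-- The partial sums of a transfinite sequence `f` of ordinals:
`0` at `0`, add `f γ` at the successor of `γ`, take the supremum at limits. -/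
noncomputable def partialSum (f : Ordinal.{u} → Ordinal.{u}) (β : Ordinal.{u}) : Ordinal.{u} :=
  Ordinal.limitRecOn β 0 (fun γ S => S + f γ) (fun β _ S => ⨆ γ : Set.Iio β, S γ.1 γ.2)

open Classical in
/-- The transfinite ordinal sum of a function `f : α → Ord`. (The values of the extension
outside `α` are never used.) -/
noncomputable def ordSum {α : Ordinal.{u}} (f : Set.Iio α → Ordinal.{u}) : Ordinal.{u} :=
  partialSum (fun γ => if h : γ < α then f ⟨γ, h⟩ else 0) α

theorem partialSum_zero (f : Ordinal.{u} → Ordinal.{u}) : partialSum f 0 = 0 := by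
  simp [partialSum]

theorem partialSum_succ (f : Ordinal.{u} → Ordinal.{u}) (γ : Ordinal.{u}) :
    partialSum f (Order.succ γ) = partialSum f γ + f γ := by
  simp [partialSum]

theorem partialSum_limit (f : Ordinal.{u} → Ordinal.{u}) {β : Ordinal.{u}}
    (hβ : Order.IsSuccLimit β) :
    partialSum f β = ⨆ γ : Set.Iio β, partialSum f γ.1 := by
  simp [partialSum, Ordinal.limitRecOn_limit, hβ]

/-! ### Syntax -/

/-- Formulas of duplex transfinite modal logic over the propositions `P`. -/
inductive Formula (P : Type v) : Type v
  | atom : P → Formula P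
  | neg : Formula P → Formula P
  | and : Formula P → Formula P → Formula P
  | box : Formula P → Formula P
  | boxbox : Formula P → Formula P

/-- The degree of a formula. -/
def Formula.deg {P : Type v} : Formula P → ℕ
  | .atom _ => 0
  | .neg φ => φ.deg
  | .and φ ψ => max φ.deg ψ.deg
  | .box φ => φ.deg + 1
  | .boxbox φ => φ.deg + 2

/-! ### Kripke models -/

/-- A Kripke model over the propositions `P`. -/
structure KripkeModel (P : Type v) where
  /-- the possible worlds -/
  World : Type u
  nonempty : Nonempty World
  /-- the accessibility relation -/
  R : World → World → Prop
  /-- the valuation -/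
  V : P → Set World

namespace KripkeModel

variable {P : Type v}

/-- The successors of `s`. -/
def succs (M : KripkeModel.{u, v} P) (s : M.World) : Set M.World := {t | M.R s t}

/-- The live successors of `s`: those that have a successor themselves. -/
def liveSuccs (M : KripkeModel.{u, v} P) (s : M.World) : Set M.World :=
  {t | M.R s t ∧ ∃ u, M.R t u}

/-- The successors of successors of `s`. -/
def grandSuccs (M : KripkeModel.{u, v} P) (s : M.World) : Set M.World :=
  {u | ∃ t, M.R s t ∧ M.R t u}

/-- `M, s` is tree-like: `M` is a tree with root `s`. Every world is reached from `s`, the root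
has no predecessor, and no world has two predecessors. -/
structure IsTreeLike (M : KripkeModel.{u, v} P) (s : M.World) : Prop where
  reachable : ∀ x, Relation.ReflTransGen M.R s x
  root : ∀ x, ¬ M.R x s
  unique_pred : ∀ x y z, M.R x z → M.R y z → x = y

/-- The number of grandsuccessors of any world of `M` is finite or a regular cardinal. -/
def HasRegularCards (M : KripkeModel.{u, v} P) : Prop :=
  ∀ x : M.World, ℵ₀ ≤ #(M.grandSuccs x) → (#(M.grandSuccs x)).IsRegular

/-- The arbitrary bijections on which the semantics of `boxbox` is built: `f s` enumerates the
live successors of `s` along the cardinal `λ_s`, and `g t` enumerates the successors of `t` along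
the cardinal `κ_t` (cardinals being initial ordinals). -/
structure Enumeration (M : KripkeModel.{u, v} P) where
  f : ∀ s : M.World, Set.Iio (#(M.liveSuccs s)).ord ≃ M.liveSuccs s
  g : ∀ t : M.World, Set.Iio (#(M.succs t)).ord ≃ M.succs t

theorem nonempty_equiv_ord {X : Type u} : Nonempty (Set.Iio (#X).ord ≃ X) := by
  apply Cardinal.lift_mk_eq'.1
  simp [Cardinal.mk_Iio_ordinal]

theorem nonempty_enumeration (M : KripkeModel.{u, v} P) : Nonempty M.Enumeration :=
  ⟨⟨fun _ => nonempty_equiv_ord.some, fun _ => nonempty_equiv_ord.some⟩⟩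

namespace Enumeration

variable {M : KripkeModel.{u, v} P}

/-- The order of the successors of `t` that satisfy `Q`, inherited from the enumeration `g t`. -/
def succLT (e : M.Enumeration) (t : M.World) (Q : M.World → Prop) :
    {x : M.succs t // Q x} → {x : M.succs t // Q x} → Prop :=
  (fun x : {x : M.succs t // Q x} => (e.g t).symm x.1) ⁻¹'o (· < ·)

instance (e : M.Enumeration) (t : M.World) (Q : M.World → Prop) :
    IsWellOrder _ (e.succLT t Q) :=
  (RelEmbedding.preimage
    (⟨fun x : {x : M.succs t // Q x} => (e.g t).symm x.1,
      (e.g t).symm.injective.comp Subtype.val_injective⟩ :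
        {x : M.succs t // Q x} ↪ Set.Iio (#(M.succs t)).ord)
    (· < ·)).isWellOrder

/-- The function `h : λ_s → Ord`, `h γ = κ_{f_s γ}`. -/
noncomputable def h (e : M.Enumeration) (s : M.World) :
    Set.Iio (#(M.liveSuccs s)).ord → Ordinal.{u} :=
  fun γ => (#(M.succs (e.f s γ))).ord

/-- The function `λ_s → Ord` that sends `γ` to the order type, under `g_{f_s γ}`, of the successors
of `f_s γ` that satisfy `Q`. -/
noncomputable def hOf (e : M.Enumeration) (s : M.World) (Q : M.World → Prop) :
    Set.Iio (#(M.liveSuccs s)).ord → Ordinal.{u} :=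
  fun γ => Ordinal.type (e.succLT (e.f s γ) Q)

end Enumeration

/-- Satisfaction of formulas at worlds of `M`, for the choice `e` of bijections. -/
def Sat (M : KripkeModel.{u, v} P) (e : M.Enumeration) : Formula P → M.World → Prop
  | .atom p, s => s ∈ M.V p
  | .neg φ, s => ¬ M.Sat e φ s
  | .and φ ψ, s => M.Sat e φ s ∧ M.Sat e ψ s
  | .box φ, s =>
      (ℵ₀ ≤ #(M.succs s) ∧
        #{t : M.World // M.R s t ∧ ¬ M.Sat e φ t} < #{t : M.World // M.R s t ∧ M.Sat e φ t}) ∨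
      (#(M.succs s) < ℵ₀ ∧ ∀ t, M.R s t → M.Sat e φ t)
  | .boxbox φ, s =>
      (∃ ζ : Ordinal.{u}, (ordSum (e.h s)).card = ℵ_ ζ ∧
        ClassLT ζ (ordSum (e.hOf s fun x => ¬ M.Sat e φ x))
          (ordSum (e.hOf s fun x => M.Sat e φ x))) ∨
      ((ordSum (e.h s)).card < ℵ₀ ∧ ∀ t x, M.R s t → M.R t x → M.Sat e φ x)

/-- The pointed models `M, s` and `N, w` are `(k, α, β)`-modal-equivalent. -/
def ModalEquiv (k : ℕ) (α β : Ordinal.{u})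
    (M : KripkeModel.{u, v} P) (e : M.Enumeration) (s : M.World)
    (N : KripkeModel.{u, v} P) (e' : N.Enumeration) (w : N.World) : Prop :=
  (∀ φ : Formula P, φ.deg ≤ k → (M.Sat e φ s ↔ N.Sat e' φ w)) ∧
  ∀ φ : Formula P, φ.deg < k →
    ((¬ ∃ t, M.R s t ∧ M.Sat e φ t) ∧ (¬ ∃ x, N.R w x ∧ N.Sat e' φ x)) ∨
    ((∃ t, M.R s t ∧ M.Sat e φ t) ∧ (∃ x, N.R w x ∧ N.Sat e' φ x) ∧
      Ordinal.log (ω_ α) (#{t : M.World // M.R s t ∧ M.Sat e φ t}).ord =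
        Ordinal.log (ω_ β) (#{x : N.World // N.R w x ∧ N.Sat e' φ x}).ord)

end KripkeModel

end TransfiniteModal

/-!
For a regular cardinal `c` the grandsuccessors of a world that satisfy a given formula, counted by
an ordinal sum of length at most `c` with terms at most `c`, can only have the sizes `c ^ i` for
`i ≤ 2` modulo `∼`, whatever the enumeration. Which of these powers is reached depends only on
whether there is such a grandsuccessor at all, whether there are `c` of them, and whether `c`
successors have `c` of them. So `⊞`, like `□`, compares cardinals of definable sets of successors.

For each `k` a world has only finitely many types of successors up to degree `k`, hence only
finitely many cardinals are relevant, namely those of the unions of type classes. They can be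
collapsed to cardinals below `ℵ_ ω`, keeping their order and the cardinals of finite sets, and the
target of a prescribed aleph can be any sufficiently large `ℵ_ n`. By induction on `k` each type has
a small tree-like copy, and the collapsed numbers of these copies are joined under a new root.
-/

namespace TransfiniteModal

/-! ### Transfinite sums of ordinals -/

section PartialSum

variable {f g : Ordinal.{u} → Ordinal.{u}} {a β γ : Ordinal.{u}} {c : Cardinal.{u}}

theorem partialSum_limit_le_iff (hβ : Order.IsSuccLimit β) :
    partialSum f β ≤ a ↔ ∀ γ < β, partialSum f γ ≤ a := by
  rw [partialSum_limit f hβ, Ordinal.iSup_le_iff]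
  exact Subtype.forall

theorem partialSum_add_one (f : Ordinal.{u} → Ordinal.{u}) (γ : Ordinal.{u}) :
    partialSum f (γ + 1) = partialSum f γ + f γ :=
  partialSum_succ f γ

theorem partialSum_mono : Monotone (partialSum f) := by
  intro γ β
  induction β using Ordinal.limitRecOn with
  | zero => intro h; rw [nonpos_iff_eq_zero.1 h]
  | add_one β ih =>
    intro h
    rcases h.eq_or_lt with rfl | h
    · exact le_rfl
    · rw [partialSum_add_one]
      exact (ih (Order.lt_add_one_iff.1 h)).trans le_self_add
  | limit β hβ ih =>
    intro h
    rcases h.eq_or_lt with rfl | h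
    · exact le_rfl
    · exact (partialSum_limit_le_iff hβ).1 le_rfl γ h

theorem partialSum_add_lt (h : γ < β) (ha : a < f γ) : partialSum f γ + a < partialSum f β := by
  refine lt_of_lt_of_le ?_ (partialSum_mono (Order.add_one_le_of_lt h))
  rw [partialSum_add_one]
  gcongr

theorem exists_partialSum_add_eq (ha : a < partialSum f β) :
    ∃ γ < β, ∃ x < f γ, partialSum f γ + x = a := by
  induction β using Ordinal.limitRecOn with
  | zero => simp [partialSum_zero] at ha
  | add_one β ih =>
    rcases lt_or_ge a (partialSum f β) with h | h
    · obtain ⟨γ, hγ, hx⟩ := ih h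
      exact ⟨γ, hγ.trans (lt_add_one β), hx⟩
    · rw [partialSum_add_one] at ha
      refine ⟨β, lt_add_one β, a - partialSum f β, ?_, Ordinal.add_sub_cancel_of_le h⟩
      rwa [← Ordinal.add_sub_cancel_of_le h, add_lt_add_iff_left] at ha
  | limit β hβ ih =>
    obtain ⟨γ, hγ, hlt⟩ : ∃ γ < β, a < partialSum f γ := by
      by_contra! h
      exact ((partialSum_limit_le_iff hβ).2 h).not_gt ha
    obtain ⟨η, hη, hx⟩ := ih γ hγ hlt
    exact ⟨η, hη.trans hγ, hx⟩

theorem card_partialSum (f : Ordinal.{u} → Ordinal.{u}) (β : Ordinal.{u}) :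
    Cardinal.lift.{u + 1} (partialSum f β).card =
      Cardinal.sum fun γ : Set.Iio β => Cardinal.lift.{u + 1} (f γ).card := by
  let place : (Σ γ : Set.Iio β, Set.Iio (f γ)) → Set.Iio (partialSum f β) :=
    fun p => ⟨partialSum f p.1 + p.2.1, partialSum_add_lt p.1.2 p.2.2⟩
  have not_lt_of_place_eq : ∀ {p q}, place p = place q → ¬ p.1 < q.1 := fun {p q} h hlt =>
    absurd (Subtype.ext_iff.1 h)
      ((partialSum_add_lt (f := f) hlt p.2.2).trans_le le_self_add).ne
  have injective : Function.Injective place := by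
    rintro ⟨γ, x⟩ ⟨η, y⟩ h
    obtain rfl : γ = η :=
      le_antisymm (not_lt.1 (not_lt_of_place_eq h.symm)) (not_lt.1 (not_lt_of_place_eq h))
    obtain rfl : x = y := Subtype.ext (add_left_cancel (Subtype.ext_iff.1 h))
    rfl
  have surjective : Function.Surjective place := by
    rintro ⟨a, ha⟩
    obtain ⟨γ, hγ, x, hx, rfl⟩ := exists_partialSum_add_eq ha
    exact ⟨⟨⟨γ, hγ⟩, ⟨x, hx⟩⟩, rfl⟩
  rw [← Cardinal.mk_Iio_ordinal, ← Cardinal.mk_congr (.ofBijective place ⟨injective, surjective⟩),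
    Cardinal.mk_sigma]
  simp only [Cardinal.mk_Iio_ordinal]

theorem partialSum_add (f : Ordinal.{u} → Ordinal.{u}) (δ β : Ordinal.{u}) :
    partialSum f (δ + β) = partialSum f δ + partialSum (fun γ => f (δ + γ)) β := by
  induction β using Ordinal.limitRecOn with
  | zero => simp [partialSum_zero]
  | add_one β ih => rw [← add_assoc, partialSum_add_one, partialSum_add_one, ih, add_assoc]
  | limit β hβ ih =>
    have := hβ.nonempty_Iio.to_subtype
    apply le_antisymm
    · refine (partialSum_limit_le_iff (Ordinal.isSuccLimit_add δ hβ)).2 fun γ hγ => ?_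
      obtain ⟨η, hη, hle⟩ := (Ordinal.lt_add_iff hβ.bot_lt.ne').1 hγ
      calc partialSum f γ ≤ partialSum f (δ + η) := partialSum_mono hle
        _ = partialSum f δ + partialSum (fun γ => f (δ + γ)) η := ih η hη
        _ ≤ _ := by gcongr; exact partialSum_mono hη.le
    · rw [partialSum_limit _ hβ, (Ordinal.isNormal_add_right _).map_iSup Ordinal.bddAbove_of_small]
      refine Ordinal.iSup_le fun γ => (ih γ γ.2).symm.le.trans (partialSum_mono ?_)
      gcongr
      exact γ.2.le

theorem partialSum_le_mul (h : ∀ γ < β, f γ ≤ a) : partialSum f β ≤ a * β := by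
  induction β using Ordinal.limitRecOn with
  | zero => simp [partialSum_zero]
  | add_one β ih =>
    rw [partialSum_add_one, mul_add_one]
    exact add_le_add (ih fun γ hγ => h γ (hγ.trans (lt_add_one β))) (h β (lt_add_one β))
  | limit β hβ ih =>
    refine (partialSum_limit_le_iff hβ).2 fun γ hγ => ?_
    exact (ih γ hγ fun η hη => h η (hη.trans hγ)).trans (by gcongr)

theorem mul_partialSum_le (h : ∀ γ < β, a * g γ ≤ f γ) :
    a * partialSum g β ≤ partialSum f β := by
  induction β using Ordinal.limitRecOn with
  | zero => simp [partialSum_zero]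
  | add_one β ih =>
    rw [partialSum_add_one, partialSum_add_one, mul_add]
    exact add_le_add (ih fun γ hγ => h γ (hγ.trans (lt_add_one β))) (h β (lt_add_one β))
  | limit β hβ ih =>
    rcases eq_zero_or_pos a with rfl | ha
    · simp
    have := hβ.nonempty_Iio.to_subtype
    rw [partialSum_limit g hβ, (Ordinal.isNormal_mul_right ha).map_iSup Ordinal.bddAbove_of_small]
    exact Ordinal.iSup_le fun γ =>
      (ih γ γ.2 fun η hη => h η (hη.trans γ.2)).trans (partialSum_mono γ.2.le)

theorem partialSum_le_ord_of_isRegular (hc : c.IsRegular) (hβ : β ≤ c.ord)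
    (h : ∀ γ < β, f γ < c.ord) : partialSum f β ≤ c.ord := by
  have partialSum_lt : ∀ γ ≤ β, γ < c.ord → partialSum f γ < c.ord := by
    intro γ hγβ hγ
    rw [Cardinal.lt_ord, ← Cardinal.lift_lt.{u, u + 1}, card_partialSum]
    refine Cardinal.sum_lt_of_isRegular hc.lift ?_ fun η =>
      Cardinal.lift_lt.2 (Cardinal.lt_ord.1 (h η (η.2.trans_le hγβ)))
    rw [Cardinal.mk_Iio_ordinal]
    exact Cardinal.lift_lt.2 (Cardinal.lt_ord.1 hγ)
  rcases hβ.eq_or_lt with rfl | hβ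
  · exact (partialSum_limit_le_iff (Cardinal.isSuccLimit_ord hc.aleph0_le)).2
      fun γ hγ => (partialSum_lt γ hγ.le hγ).le
  · exact (partialSum_lt β le_rfl hβ).le

end PartialSum

section Class

variable {ζ a b i : Ordinal.{u}}

theorem one_lt_omega (ζ : Ordinal.{u}) : 1 < ω_ ζ :=
  one_lt_omega0.trans_le (omega0_le_omega ζ)

theorem mul_omega_le_opow (h : a < ω_ ζ ^ i) : a * ω_ ζ ≤ ω_ ζ ^ i := by
  rcases eq_or_ne a 0 with rfl | ha
  · simp
  set j := Ordinal.log (ω_ ζ) a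
  have hlt : j < i := (Ordinal.lt_opow_iff_log_lt (one_lt_omega ζ) ha).1 h
  have hquot : Order.succ (a / ω_ ζ ^ j) < ω_ ζ :=
    (isSuccLimit_omega ζ).succ_lt (Ordinal.div_opow_log_lt a (one_lt_omega ζ))
  have habsorb : Order.succ (a / ω_ ζ ^ j) * ω_ ζ = ω_ ζ :=
    isPrincipal_mul_iff_mul_left_eq.1 (isPrincipal_mul_omega ζ) _ (Order.bot_lt_succ _) hquot
  calc a * ω_ ζ ≤ ω_ ζ ^ j * Order.succ (a / ω_ ζ ^ j) * ω_ ζ := by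
        gcongr
        exact (Ordinal.lt_mul_succ_div a (Ordinal.opow_pos j (omega_pos ζ)).ne').le
    _ = ω_ ζ ^ Order.succ j := by rw [mul_assoc, habsorb, Ordinal.opow_succ]
    _ ≤ ω_ ζ ^ i := Ordinal.opow_le_opow_right (omega_pos ζ) (Order.succ_le_of_lt hlt)

/-- The powers of `ω_ ζ` are the least members of the nonzero classes modulo `∼_ζ`, since
`a < ω_ ζ ^ i` forces `a * ω_ ζ ≤ ω_ ζ ^ i`. -/
theorem classLT_iff_exists_opow :
    ClassLT ζ a b ↔ ∃ i : Ordinal.{u}, a < ω_ ζ ^ i ∧ ω_ ζ ^ i ≤ b := by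
  constructor
  · rintro ⟨hsim, hab⟩
    have hb : b ≠ 0 := (pos_of_gt hab).ne'
    have hle := Ordinal.opow_log_le_self (ω_ ζ) hb
    refine ⟨Ordinal.log (ω_ ζ) b, not_le.1 fun hla => hsim <|
      Or.inr ⟨Or.inr (pos_of_gt hab), ?_, ?_⟩, hle⟩
    · exact hab.trans_le (le_mul_of_one_le_right zero_le (one_lt_omega ζ).le)
    · refine (Ordinal.lt_opow_succ_log_self (one_lt_omega ζ) b).trans_le ?_
      rw [Ordinal.opow_succ]
      gcongr
  · rintro ⟨i, hai, hib⟩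
    refine ⟨?_, hai.trans_le hib⟩
    rintro (⟨rfl, rfl⟩ | ⟨-, -, hba⟩)
    · exact absurd (hai.trans_le hib) (lt_irrefl 0)
    · exact absurd (hba.trans_le ((mul_omega_le_opow hai).trans hib)) (lt_irrefl b)

end Class

section Sum

variable {ι : Type u} {f : ι → Cardinal.{u}} {c : Cardinal.{u}}

theorem sum_subtype_of_ne_zero (p : ι → Prop) (hp : ∀ i, f i ≠ 0 → p i) :
    Cardinal.sum (fun i : {i // p i} => f i) = Cardinal.sum f :=
  Cardinal.mk_congr <| Equiv.sigmaSubtypeEquivOfSubset (fun i => (f i).out) p fun i x =>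
    hp i <| by
      rw [← Cardinal.mk_out (f i)]
      exact Cardinal.mk_ne_zero_iff.2 ⟨x⟩

theorem le_sum_iff_of_isRegular (hc : c.IsRegular) :
    c ≤ Cardinal.sum f ↔ (∃ i, c ≤ f i) ∨ c ≤ #{i // f i ≠ 0} := by
  constructor
  · contrapose!
    rintro ⟨hf, hsupp⟩
    rw [← sum_subtype_of_ne_zero (fun i => f i ≠ 0) fun _ => id]
    exact Cardinal.sum_lt_of_isRegular hc hsupp fun i => hf i
  · rintro (⟨i, hi⟩ | hsupp)
    · exact hi.trans (Cardinal.le_sum f i)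
    · rw [← sum_subtype_of_ne_zero (fun i => f i ≠ 0) fun _ => id]
      refine hsupp.trans ?_
      calc #{i // f i ≠ 0} = Cardinal.sum fun _ : {i // f i ≠ 0} => (1 : Cardinal.{u}) := by simp
        _ ≤ _ := Cardinal.sum_le_sum _ _ fun i => Cardinal.one_le_iff_ne_zero.2 i.2

end Sum

section OrdSum

variable {Λ : Ordinal.{u}} {a : Ordinal.{u}} {c : Cardinal.{u}}

theorem ordSum_le_mul {f : Set.Iio Λ → Ordinal.{u}} (h : ∀ γ, f γ ≤ a) : ordSum f ≤ a * Λ :=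
  partialSum_le_mul fun γ hγ => by simpa only [dif_pos hγ] using h ⟨γ, hγ⟩

theorem mul_ordSum_le {f g : Set.Iio Λ → Ordinal.{u}} (h : ∀ γ, a * g γ ≤ f γ) :
    a * ordSum g ≤ ordSum f :=
  mul_partialSum_le fun γ hγ => by simpa only [dif_pos hγ] using h ⟨γ, hγ⟩

variable {X : Type u}

theorem card_ordSum (e : Set.Iio Λ ≃ X) (G : X → Ordinal.{u}) :
    (ordSum (G ∘ e)).card = Cardinal.sum fun x => (G x).card := by
  rw [← Cardinal.lift_inj.{u, u + 1}, ordSum, card_partialSum, Cardinal.lift_sum]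
  have hval : ∀ γ : Set.Iio Λ, (if h : γ.1 < Λ then (G ∘ e) ⟨γ, h⟩ else 0) = G (e γ) :=
    fun γ => dif_pos γ.2
  simp only [hval]
  exact Cardinal.mk_sigma_congr'.{u + 1, u, u + 1} e fun γ => by simp only [Cardinal.mk_out]

theorem ordSum_lt_ord_mul_ord (hc : c.IsRegular) (hΛ : Λ ≤ c.ord) {δ : Ordinal.{u}}
    (hδ : δ < c.ord) {f : Set.Iio Λ → Ordinal.{u}} (hf : ∀ γ, f γ ≤ c.ord)
    (hlt : ∀ γ : Set.Iio Λ, δ ≤ γ → f γ < c.ord) : ordSum f < c.ord * c.ord := by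
  let F : Ordinal.{u} → Ordinal.{u} := fun γ => if h : γ < Λ then f ⟨γ, h⟩ else 0
  have le_ord : ∀ γ < δ, F γ ≤ c.ord := fun γ _ => by
    by_cases h : γ < Λ
    · simpa only [F, dif_pos h] using hf ⟨γ, h⟩
    · simp only [F, dif_neg h, zero_le]
  have lt_ord : ∀ γ < Λ, F (δ + γ) < c.ord := fun γ _ => by
    by_cases h : δ + γ < Λ
    · simpa only [F, dif_pos h] using hlt ⟨δ + γ, h⟩ le_self_add
    · simpa only [F, dif_neg h] using hc.ord_pos
  calc partialSum F Λ ≤ partialSum F (δ + Λ) := partialSum_mono le_add_self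
    _ = partialSum F δ + partialSum (fun γ => F (δ + γ)) Λ := partialSum_add F δ Λ
    _ ≤ c.ord * δ + c.ord :=
      add_le_add (partialSum_le_mul le_ord) (partialSum_le_ord_of_isRegular hc hΛ lt_ord)
    _ = c.ord * (δ + 1) := (mul_add_one _ _).symm
    _ < c.ord * c.ord := mul_lt_mul_of_pos_left
      ((Cardinal.isSuccLimit_ord hc.aleph0_le).add_one_lt hδ) hc.ord_pos

theorem exists_lt_ord_forall_not_of_mk_lt (hc : c.IsRegular) (hΛ : Λ ≤ c.ord) (e : Set.Iio Λ ≃ X)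
    {p : X → Prop} (hp : #{x // p x} < c) :
    ∃ δ < c.ord, ∀ γ : Set.Iio Λ, δ ≤ γ → ¬ p (e γ) := by
  refine ⟨⨆ x : {x // p x}, (e.symm x : Ordinal.{u}) + 1, ?_, fun γ hγ hpγ => ?_⟩
  · exact Ordinal.iSup_add_one_lt_of_lt_cof (by simpa [hc.cof_ord] using hp)
      fun x => (e.symm x).2.trans_le hΛ
  · have := Ordinal.le_iSup (fun x : {x // p x} => (e.symm x : Ordinal.{u}) + 1) ⟨e γ, hpγ⟩
    simp only [Equiv.symm_apply_apply] at this
    exact ((lt_add_one _).trans_le this).not_ge hγ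

theorem ord_mul_ord_le_ordSum_iff (hc : c.IsRegular) (hΛ : Λ ≤ c.ord) (e : Set.Iio Λ ≃ X)
    {G : X → Ordinal.{u}} (hG : ∀ x, G x ≤ c.ord) :
    c.ord * c.ord ≤ ordSum (G ∘ e) ↔ c ≤ #{x // c.ord ≤ G x} := by
  classical
  constructor
  · contrapose!
    intro hlt
    obtain ⟨δ, hδ, hsmall⟩ := exists_lt_ord_forall_not_of_mk_lt hc hΛ e hlt
    exact ordSum_lt_ord_mul_ord hc hΛ hδ (fun γ => hG (e γ)) fun γ hγ => not_le.1 (hsmall γ hγ)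
  · intro hle
    let indicator : X → Ordinal.{u} := fun x => if c.ord ≤ G x then 1 else 0
    have hind : c.ord ≤ ordSum (indicator ∘ e) := by
      rw [Cardinal.ord_le, card_ordSum]
      have hsupp : ∀ x, (indicator x).card ≠ 0 → c.ord ≤ G x := fun x hx => by
        by_contra h
        simp only [indicator, if_neg h, Ordinal.card_zero, ne_eq, not_true_eq_false] at hx
      refine hle.trans_eq ?_
      rw [← sum_subtype_of_ne_zero _ hsupp]
      have hone : ∀ x : {x // c.ord ≤ G x}, (indicator x).card = 1 := fun x => by
        simp only [indicator, if_pos x.2, Ordinal.card_one]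
      simp only [hone, Cardinal.sum_const, Cardinal.lift_id, mul_one]
    calc c.ord * c.ord ≤ c.ord * ordSum (indicator ∘ e) := by gcongr
      _ ≤ ordSum (G ∘ e) := mul_ordSum_le fun γ => by
        simp only [Function.comp_apply, indicator]
        split_ifs with h
        · rwa [mul_one]
        · rw [mul_zero]; exact zero_le

end OrdSum

/-! ### Semantics without enumerations -/

section Count

variable {X : Type u} {A : Set X} {Q : X → Prop}

/-- The number of elements of `A` that satisfy `Q`. -/
def count (A : Set X) (Q : X → Prop) : Cardinal.{u} :=
  #{x // x ∈ A ∧ Q x}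

/-- The interpretation of `□`: most elements of `A` satisfy `Q` if `A` is infinite, and all of them
do if `A` is finite. -/
def Majority (A : Set X) (Q : X → Prop) : Prop :=
  (ℵ₀ ≤ #A ∧ count A (fun x => ¬ Q x) < count A Q) ∨ (#A < ℵ₀ ∧ ∀ x ∈ A, Q x)

theorem count_eq_mk_subtype (A : Set X) (Q : X → Prop) : count A Q = #{x : A // Q x} :=
  Cardinal.mk_congr (Equiv.subtypeSubtypeEquivSubtypeInter (· ∈ A) Q).symm

theorem count_true (A : Set X) : count A (fun _ => True) = #A :=
  Cardinal.mk_congr (Equiv.subtypeEquivRight fun _ => iff_of_eq (and_true _))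

theorem count_eq_zero : count A Q = 0 ↔ ∀ x ∈ A, ¬ Q x := by
  simp only [count, Cardinal.mk_eq_zero_iff, isEmpty_subtype, not_and]

theorem count_ne_zero : count A Q ≠ 0 ↔ ∃ x ∈ A, Q x := by
  simp only [ne_eq, count_eq_zero, not_forall, not_not, exists_prop]

theorem count_le_mk (A : Set X) (Q : X → Prop) : count A Q ≤ #A :=
  Cardinal.mk_subtype_le_of_subset fun _ => And.left

theorem count_iUnion {ι : Type u} {B : ι → Set X} (hB : Pairwise (Function.onFun Disjoint B)) :
    count (⋃ i, B i) Q = Cardinal.sum fun i => count (B i) Q := by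
  have hdisj : Pairwise (Function.onFun Disjoint fun i => {x | x ∈ B i ∧ Q x}) :=
    fun i j hij => (hB hij).mono (fun _ => And.left) fun _ => And.left
  have hunion : {x | (x ∈ ⋃ i, B i) ∧ Q x} = ⋃ i, {x | x ∈ B i ∧ Q x} := by
    ext x
    simp only [Set.mem_iUnion, Set.mem_ofPred_eq, exists_and_right]
  exact (congrArg (fun S : Set X => #S) hunion).trans (Cardinal.mk_iUnion_eq_sum_mk hdisj)

end Count

namespace KripkeModel

variable {P : Type v} (M : KripkeModel.{u, v} P)

/-- For a regular cardinal `c`, `M.Reaches c s Q i` says that the ordinal sum which counts the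
grandsuccessors of `s` satisfying `Q` is at least the `i`-th power of the initial ordinal of `c`,
provided that `s` has at most `c` grandsuccessors. No such sum reaches the third power. -/
def Reaches (c : Cardinal.{u}) (s : M.World) (Q : M.World → Prop) : ℕ → Prop
  | 0 => ∃ x ∈ M.grandSuccs s, Q x
  | 1 => c ≤ count (M.grandSuccs s) Q
  | 2 => c ≤ count (M.succs s) fun t => c ≤ count (M.succs t) Q
  | _ + 3 => False

/-- The interpretation of `⊞` without reference to an enumeration. -/
def GrandMajority (s : M.World) (Q : M.World → Prop) : Prop :=
  (ℵ₀ ≤ #(M.grandSuccs s) ∧ ∃ i, M.Reaches #(M.grandSuccs s) s Q i ∧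
    ¬ M.Reaches #(M.grandSuccs s) s (fun x => ¬ Q x) i) ∨
  (#(M.grandSuccs s) < ℵ₀ ∧ ∀ x ∈ M.grandSuccs s, Q x)

/-- Satisfaction of formulas without reference to an enumeration. -/
def Holds : Formula P → M.World → Prop
  | .atom p, s => s ∈ M.V p
  | .neg φ, s => ¬ Holds φ s
  | .and φ ψ, s => Holds φ s ∧ Holds ψ s
  | .box φ, s => Majority (M.succs s) (Holds φ)
  | .boxbox φ, s => M.GrandMajority s (Holds φ)

variable {M} {s : M.World} {Q : M.World → Prop} {c : Cardinal.{u}}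

theorem grandSuccs_eq_iUnion (s : M.World) :
    M.grandSuccs s = ⋃ t : M.liveSuccs s, M.succs t := by
  ext x
  simp only [grandSuccs, liveSuccs, succs, Set.mem_ofPred_eq, Set.mem_iUnion, Subtype.exists,
    exists_prop]
  exact ⟨fun ⟨t, hst, htx⟩ => ⟨t, ⟨hst, x, htx⟩, htx⟩, fun ⟨t, ht, htx⟩ => ⟨t, ht.1, htx⟩⟩

theorem mk_succs_le_mk_grandSuccs {t : M.World} (h : M.R s t) :
    #(M.succs t) ≤ #(M.grandSuccs s) :=
  Cardinal.mk_le_mk_of_subset fun _ hx => ⟨t, h, hx⟩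

theorem mk_liveSuccs_subtype {p : M.World → Prop} (hp : ∀ t, p t → ∃ u, M.R t u) :
    #{t : M.liveSuccs s // p t} = count (M.succs s) p :=
  (count_eq_mk_subtype _ _).symm.trans <| Cardinal.mk_congr <| Equiv.subtypeEquivRight fun t =>
    ⟨fun h => ⟨h.1.1, h.2⟩, fun h => ⟨⟨h.1, hp t h.2⟩, h.2⟩⟩

namespace Enumeration

variable (e : M.Enumeration)

theorem card_type_succLT (t : M.World) (Q : M.World → Prop) :
    (Ordinal.type (e.succLT t Q)).card = count (M.succs t) Q := by
  rw [Ordinal.card_type, count_eq_mk_subtype]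

theorem type_succLT_le (t : M.World) (Q : M.World → Prop) :
    Ordinal.type (e.succLT t Q) ≤ (#(M.succs t)).ord := by
  have h := Ordinal.lift_type_le.{u, u + 1, u + 1}.2
    ⟨(⟨⟨fun x : {x : M.succs t // Q x} => (e.g t).symm x.1,
      (e.g t).symm.injective.comp Subtype.val_injective⟩, Iff.rfl⟩ :
        e.succLT t Q ↪r (· < · : Set.Iio (#(M.succs t)).ord → _ → Prop)).collapse⟩
  rw [Ordinal.type_lt_Iio, Ordinal.lift_lift] at h
  exact Ordinal.lift_le.1 h

theorem hOf_eq_comp (s : M.World) (Q : M.World → Prop) :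
    e.hOf s Q = (fun t : M.liveSuccs s => Ordinal.type (e.succLT t Q)) ∘ e.f s :=
  rfl

theorem type_succLT_le_ord_mk_grandSuccs (t : M.liveSuccs s) (Q : M.World → Prop) :
    Ordinal.type (e.succLT t Q) ≤ (#(M.grandSuccs s)).ord :=
  (e.type_succLT_le t Q).trans (Cardinal.ord_le_ord.2 (mk_succs_le_mk_grandSuccs t.2.1))

end Enumeration

section LeftUnique

variable (hR : Relator.LeftUnique M.R)

include hR

theorem count_grandSuccs (s : M.World) (Q : M.World → Prop) :
    count (M.grandSuccs s) Q = Cardinal.sum fun t : M.liveSuccs s => count (M.succs t) Q := by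
  rw [grandSuccs_eq_iUnion, count_iUnion]
  exact fun t t' htt' => Set.disjoint_left.2 fun x hx hx' => htt' (Subtype.ext (hR hx hx'))

theorem mk_grandSuccs (s : M.World) :
    #(M.grandSuccs s) = Cardinal.sum fun t : M.liveSuccs s => #(M.succs t) := by
  simpa only [count_true] using count_grandSuccs hR s fun _ => True

theorem mk_liveSuccs_le_mk_grandSuccs (s : M.World) : #(M.liveSuccs s) ≤ #(M.grandSuccs s) := by
  rw [mk_grandSuccs hR]
  calc #(M.liveSuccs s) = Cardinal.sum fun _ : M.liveSuccs s => (1 : Cardinal.{u}) := by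
        rw [Cardinal.sum_const, Cardinal.lift_id, Cardinal.lift_id, mul_one]
    _ ≤ _ := Cardinal.sum_le_sum _ _ fun t =>
        Cardinal.one_le_iff_ne_zero.2 (Cardinal.mk_ne_zero_iff.2 (Set.nonempty_coe_sort.2 t.2.2))

theorem le_count_grandSuccs_iff (hc : c.IsRegular) :
    c ≤ count (M.grandSuccs s) Q ↔ (∃ t ∈ M.succs s, c ≤ count (M.succs t) Q) ∨
      c ≤ count (M.succs s) fun t => ∃ x ∈ M.succs t, Q x := by
  rw [count_grandSuccs hR, le_sum_iff_of_isRegular hc]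
  simp only [count_ne_zero]
  rw [mk_liveSuccs_subtype (p := fun t => ∃ x ∈ M.succs t, Q x) fun t ⟨x, hx, _⟩ => ⟨x, hx⟩]
  refine or_congr_left ⟨fun ⟨t, ht⟩ => ⟨t, t.2.1, ht⟩, fun ⟨t, hst, ht⟩ => ⟨⟨t, hst, ?_⟩, ht⟩⟩
  obtain ⟨x, hx, -⟩ := count_ne_zero.1 (hc.pos.trans_le ht).ne'
  exact ⟨x, hx⟩

namespace Enumeration

variable (e : M.Enumeration)

theorem card_ordSum_hOf (s : M.World) (Q : M.World → Prop) :
    (ordSum (e.hOf s Q)).card = count (M.grandSuccs s) Q := by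
  simp only [hOf_eq_comp, card_ordSum, card_type_succLT, count_grandSuccs hR]

theorem card_ordSum_h (s : M.World) : (ordSum (e.h s)).card = #(M.grandSuccs s) := by
  rw [mk_grandSuccs hR]
  refine (card_ordSum (e.f s) fun t => (#(M.succs t)).ord).trans ?_
  simp only [Cardinal.card_ord]

theorem ordSum_hOf_le (s : M.World) (Q : M.World → Prop) :
    ordSum (e.hOf s Q) ≤ (#(M.grandSuccs s)).ord ^ 2 :=
  calc ordSum (e.hOf s Q) ≤ (#(M.grandSuccs s)).ord * (#(M.liveSuccs s)).ord :=
        ordSum_le_mul fun γ => e.type_succLT_le_ord_mk_grandSuccs (e.f s γ) Q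
    _ ≤ (#(M.grandSuccs s)).ord * (#(M.grandSuccs s)).ord := by
        gcongr
        exact mk_liveSuccs_le_mk_grandSuccs hR s
    _ = (#(M.grandSuccs s)).ord ^ 2 := (pow_two _).symm

theorem ord_pow_le_ordSum_hOf_iff (hc : (#(M.grandSuccs s)).IsRegular) (i : ℕ) :
    (#(M.grandSuccs s)).ord ^ i ≤ ordSum (e.hOf s Q) ↔ M.Reaches #(M.grandSuccs s) s Q i := by
  match i with
  | 0 =>
    rw [pow_zero, Order.one_le_iff_pos, pos_iff_ne_zero, ne_eq, ← Ordinal.card_eq_zero,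
      card_ordSum_hOf hR]
    exact count_ne_zero
  | 1 => rw [pow_one, Cardinal.ord_le, card_ordSum_hOf hR, Reaches]
  | 2 =>
    rw [pow_two, hOf_eq_comp, ord_mul_ord_le_ordSum_iff hc
      (Cardinal.ord_le_ord.2 (mk_liveSuccs_le_mk_grandSuccs hR s)) _
      fun t => e.type_succLT_le_ord_mk_grandSuccs t Q]
    simp only [Cardinal.ord_le, card_type_succLT, Reaches]
    rw [mk_liveSuccs_subtype fun t (ht : #(M.grandSuccs s) ≤ count (M.succs t) Q) =>
      (count_ne_zero.1 (hc.pos.trans_le ht).ne').imp fun _ => And.left]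
  | i + 3 =>
    refine iff_of_false (fun h => ?_) id
    have hone : 1 < (#(M.grandSuccs s)).ord := by
      rw [Cardinal.lt_ord, Ordinal.card_one]
      exact Cardinal.one_lt_aleph0.trans_le hc.aleph0_le
    exact (h.trans (ordSum_hOf_le hR e s Q)).not_gt
      (pow_lt_pow_right₀ hone (by lia))

theorem classLT_ordSum_hOf_iff {ζ : Ordinal.{u}} (hζ : #(M.grandSuccs s) = ℵ_ ζ)
    (hc : (#(M.grandSuccs s)).IsRegular) :
    ClassLT ζ (ordSum (e.hOf s fun x => ¬ Q x)) (ordSum (e.hOf s Q)) ↔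
      ∃ i, M.Reaches #(M.grandSuccs s) s Q i ∧
        ¬ M.Reaches #(M.grandSuccs s) s (fun x => ¬ Q x) i := by
  have hω : ω_ ζ = (#(M.grandSuccs s)).ord := by rw [hζ, ord_aleph]
  simp only [← ord_pow_le_ordSum_hOf_iff hR e hc, not_le, classLT_iff_exists_opow, hω,
    ← Ordinal.opow_natCast]
  refine ⟨fun ⟨i, hlt, hle⟩ => ?_, fun ⟨i, hle, hlt⟩ => ⟨i, hlt, hle⟩⟩
  have hi : i ≤ 2 := by
    have := hle.trans (ordSum_hOf_le hR e s Q)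
    rw [← hω, ← Ordinal.opow_natCast] at this
    exact_mod_cast (Ordinal.opow_le_opow_iff_right (one_lt_omega ζ)).1 this
  obtain ⟨n, rfl⟩ := Ordinal.lt_omega0.1 (hi.trans_lt (Ordinal.natCast_lt_omega0 2))
  exact ⟨n, hle, hlt⟩

end Enumeration

theorem sat_iff_holds (hM : M.HasRegularCards) (e : M.Enumeration) (φ : Formula P) (s : M.World) :
    M.Sat e φ s ↔ M.Holds φ s := by
  induction φ generalizing s with
  | atom p => rfl
  | neg φ ih => exact not_congr (ih s)
  | and φ ψ ihφ ihψ => exact and_congr (ihφ s) (ihψ s)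
  | box φ ih =>
    simp only [Sat, ih]
    rfl
  | boxbox φ ih =>
    simp only [Sat, ih, e.card_ordSum_h hR, Holds, GrandMajority]
    refine or_congr ⟨?_, ?_⟩ ?_
    · rintro ⟨ζ, hζ, hlt⟩
      have hinf : ℵ₀ ≤ #(M.grandSuccs s) := hζ ▸ aleph0_le_aleph ζ
      exact ⟨hinf, (e.classLT_ordSum_hOf_iff hR hζ (hM s hinf)).1 hlt⟩
    · rintro ⟨hinf, hreach⟩
      obtain ⟨ζ, hζ⟩ := mem_range_aleph_iff.2 hinf
      exact ⟨ζ, hζ.symm, (e.classLT_ordSum_hOf_iff hR hζ.symm (hM s hinf)).2 hreach⟩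
    · exact and_congr_right fun _ => ⟨fun h x ⟨t, hst, htx⟩ => h t x hst htx,
        fun h t x hst htx => h x ⟨t, hst, htx⟩⟩

end LeftUnique

end KripkeModel

/-! ### Collapsing cardinals -/

open Classical in
/-- Finite cardinals are kept, and an infinite cardinal is sent to `ℵ_ (m + i)` if exactly `i`
members of `A` are below it. This is an additive map to the cardinals below `ℵ_ ω` which reflects
the order in relation to the members of `A`. -/
noncomputable def collapse (A : Finset Cardinal.{u}) (m : ℕ) (c : Cardinal.{u}) : Cardinal.{u} :=
  if c < ℵ₀ then c else ℵ_ ((m + {d ∈ A | d < c}.card : ℕ) : Ordinal.{u})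

section Collapse

variable {A : Finset Cardinal.{u}} {m : ℕ} {c d : Cardinal.{u}}

theorem collapse_of_lt_aleph0 (h : c < ℵ₀) : collapse A m c = c :=
  if_pos h

theorem collapse_zero : collapse A m 0 = 0 :=
  collapse_of_lt_aleph0 aleph0_pos

theorem aleph0_le_collapse : ℵ₀ ≤ collapse A m c ↔ ℵ₀ ≤ c := by
  unfold collapse
  split_ifs with h
  · rfl
  · exact iff_of_true (aleph0_le_aleph _) (not_lt.1 h)

theorem collapse_lt_aleph0 : collapse A m c < ℵ₀ ↔ c < ℵ₀ := by
  rw [← not_le, aleph0_le_collapse, not_le]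

theorem collapse_eq_zero : collapse A m c = 0 ↔ c = 0 := by
  refine ⟨fun h => ?_, fun h => by rw [h, collapse_zero]⟩
  rwa [collapse_of_lt_aleph0 (collapse_lt_aleph0.1 (h ▸ aleph0_pos))] at h

theorem collapse_lt_aleph_omega : collapse A m c < ℵ_ ω := by
  unfold collapse
  split_ifs with h
  · exact h.trans_le (aleph0_le_aleph ω)
  · exact aleph_lt_aleph.2 (natCast_lt_omega0 _)

theorem collapse_mono : Monotone (collapse A m) := by
  intro c d hcd
  rcases lt_or_ge c ℵ₀ with hc | hc
  · rcases lt_or_ge d ℵ₀ with hd | hd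
    · rwa [collapse_of_lt_aleph0 hc, collapse_of_lt_aleph0 hd]
    · exact (collapse_lt_aleph0.2 hc).le.trans (aleph0_le_collapse.2 hd)
  · rw [collapse, collapse, if_neg hc.not_gt, if_neg (hc.trans hcd).not_gt, aleph_le_aleph,
      Nat.cast_le]
    gcongr

theorem collapse_lt_iff (hc : c ∈ A) : collapse A m c < collapse A m d ↔ c < d := by
  refine ⟨collapse_mono.reflect_lt, fun hcd => ?_⟩
  rcases lt_or_ge d ℵ₀ with hd | hd
  · rwa [collapse_of_lt_aleph0 hd, collapse_of_lt_aleph0 (hcd.trans hd)]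
  rcases lt_or_ge c ℵ₀ with hc₀ | hc₀
  · exact (collapse_lt_aleph0.2 hc₀).trans_le (aleph0_le_collapse.2 hd)
  rw [collapse, collapse, if_neg hc₀.not_gt, if_neg hd.not_gt, aleph_lt_aleph, Nat.cast_lt]
  refine Nat.add_lt_add_left (Finset.card_lt_card (Finset.ssubset_iff_of_subset ?_ |>.2 ?_)) m
  · exact Finset.monotone_filter_right A fun x _ hx => hx.trans hcd
  · exact ⟨c, Finset.mem_filter.2 ⟨hc, hcd⟩, fun h => (Finset.mem_filter.1 h).2.false⟩

theorem collapse_le_iff (hc : c ∈ A) : collapse A m d ≤ collapse A m c ↔ d ≤ c := by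
  rw [← not_lt, collapse_lt_iff hc, not_lt]

theorem collapse_add (c d : Cardinal.{u}) :
    collapse A m (c + d) = collapse A m c + collapse A m d := by
  wlog hcd : c ≤ d generalizing c d
  · rw [add_comm, this d c (le_of_not_ge hcd), add_comm]
  rcases lt_or_ge d ℵ₀ with hd | hd
  · have hc := hcd.trans_lt hd
    rw [collapse_of_lt_aleph0 (Cardinal.add_lt_aleph0 hc hd), collapse_of_lt_aleph0 hc,
      collapse_of_lt_aleph0 hd]
  · rw [Cardinal.add_eq_right hd hcd,
      Cardinal.add_eq_right (aleph0_le_collapse.2 hd) (collapse_mono hcd)]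

theorem exists_collapse_aleph_eq (A : Finset Cardinal.{u}) (m : ℕ) (ζ : Ordinal.{u}) :
    ∃ n, m ≤ n ∧ collapse A m (ℵ_ ζ) = ℵ_ (n : Ordinal.{u}) :=
  ⟨_, Nat.le_add_right _ _, if_neg (aleph0_le_aleph ζ).not_gt⟩

theorem exists_collapse_aleph_eq_aleph (α : Ordinal.{u}) {n : ℕ} (hn : m + A.card ≤ n) :
    ∃ n₀, m ≤ n₀ ∧ collapse A n₀ (ℵ_ α) = ℵ_ (n : Ordinal.{u}) := by
  have hle : {d ∈ A | d < ℵ_ α}.card ≤ A.card := Finset.card_filter_le _ _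
  refine ⟨n - {d ∈ A | d < ℵ_ α}.card, by lia, ?_⟩
  rw [collapse, if_neg (aleph0_le_aleph α).not_gt, Nat.sub_add_cancel (by lia)]

/-- The colour classes of `g'` have the collapsed sizes of the colour classes of `g`, and the
collapse reflects the order in relation to the sizes of the unions of colour classes of `g`. -/
structure IsCollapse (A : Finset Cardinal.{u}) (m : ℕ) {J J' : Type u} {T : Type v} (g : J → T)
    (g' : J' → T) : Prop where
  mk_preimage_mem : ∀ B : Set T, #(g ⁻¹' B) ∈ A
  mk_fiber : ∀ τ, #(g' ⁻¹' {τ}) = collapse A m #(g ⁻¹' {τ})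

namespace IsCollapse

variable {J J' : Type u} {T : Type v} {g : J → T} {g' : J' → T} {Q : J → Prop} {Q' : J' → Prop}

theorem mk_preimage [Finite T] (h : IsCollapse A m g g') (B : Set T) :
    #(g' ⁻¹' B) = collapse A m #(g ⁻¹' B) := by
  have insert_eq {J : Type u} (g : J → T) {τ : T} {B : Set T} (hτ : τ ∉ B) :
      #(g ⁻¹' insert τ B) = #(g ⁻¹' {τ}) + #(g ⁻¹' B) := by
    rw [Set.insert_eq, Set.preimage_union, Cardinal.mk_union_of_disjoint]
    exact Disjoint.preimage _ (Set.disjoint_singleton_left.2 hτ)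
  induction B, B.toFinite using Set.Finite.induction_on with
  | empty => simp only [Set.preimage_empty, Cardinal.mk_eq_zero, collapse_zero]
  | insert hτ _ ih => rw [insert_eq g hτ, insert_eq g' hτ, collapse_add, h.mk_fiber, ih]

theorem mem_range_iff (h : IsCollapse A m g g') (τ : T) :
    τ ∈ Set.range g ↔ τ ∈ Set.range g' := by
  have nonempty_fiber_iff {J : Type u} (g : J → T) : τ ∈ Set.range g ↔ #(g ⁻¹' {τ}) ≠ 0 :=
    Set.nonempty_coe_sort.symm.trans Cardinal.mk_ne_zero_iff.symm
  rw [nonempty_fiber_iff, nonempty_fiber_iff, h.mk_fiber, ne_eq, ne_eq, collapse_eq_zero]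

theorem exists_preimage_eq (h : IsCollapse A m g g') (hQ : ∀ j j', g j = g' j' → (Q j ↔ Q' j')) :
    ∃ B : Set T, {j | Q j} = g ⁻¹' B ∧ {j' | Q' j'} = g' ⁻¹' B := by
  refine ⟨g '' {j | Q j}, (Set.subset_preimage_image g _).antisymm ?_, ?_⟩
  · rintro j ⟨i, hi, hij⟩
    obtain ⟨j', hj'⟩ := (h.mem_range_iff (g j)).1 ⟨j, rfl⟩
    exact (hQ j j' hj'.symm).2 ((hQ i j' (hij.trans hj'.symm)).1 hi)
  · ext j'
    constructor
    · intro hj'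
      obtain ⟨j, hj⟩ := (h.mem_range_iff (g' j')).2 ⟨j', rfl⟩
      exact ⟨j, (hQ j j' hj).2 hj', hj⟩
    · rintro ⟨j, hj, hjj'⟩
      exact (hQ j j' hjj').1 hj

theorem mk_subtype_eq [Finite T] (h : IsCollapse A m g g')
    (hQ : ∀ j j', g j = g' j' → (Q j ↔ Q' j')) : #{j' // Q' j'} = collapse A m #{j // Q j} := by
  obtain ⟨B, hB, hB'⟩ := h.exists_preimage_eq hQ
  change #{j' | Q' j'} = collapse A m #{j | Q j}
  rw [hB, hB', h.mk_preimage]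

theorem mk_subtype_mem (h : IsCollapse A m g g')
    (hQ : ∀ j j', g j = g' j' → (Q j ↔ Q' j')) : #{j // Q j} ∈ A := by
  obtain ⟨B, hB, -⟩ := h.exists_preimage_eq hQ
  change #{j | Q j} ∈ A
  exact hB ▸ h.mk_preimage_mem B

end IsCollapse

end Collapse

/-! ### Agreement up to a degree -/

/-- Whether `c` vanishes, is finite, and reaches `ℵ_ α`. For `c ≤ ℵ_ α` this determines the
logarithm of `c` to the base `ℵ_ α`. -/
def scale (α : Ordinal.{u}) (c : Cardinal.{u}) : Prop × Prop × Prop :=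
  (c = 0, c < ℵ₀, ℵ_ α ≤ c)

section Scale

variable {α β : Ordinal.{u}} {c d : Cardinal.{u}}

theorem scale_eq_scale_iff :
    scale α c = scale β d ↔ (c = 0 ↔ d = 0) ∧ (c < ℵ₀ ↔ d < ℵ₀) ∧ (ℵ_ α ≤ c ↔ ℵ_ β ≤ d) := by
  simp only [scale, Prod.mk.injEq, eq_iff_iff]

theorem scale_collapse {A : Finset Cardinal.{u}} {m : ℕ} (hc : c ∈ A)
    (hα : collapse A m (ℵ_ α) = ℵ_ β) : scale α c = scale β (collapse A m c) :=
  scale_eq_scale_iff.2 ⟨collapse_eq_zero.symm, collapse_lt_aleph0.symm,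
    by rw [← hα, collapse_le_iff hc]⟩

end Scale

namespace KripkeModel

variable {P : Type v}

/-- `M, s` and `N, w` agree on formulas of degree at most `k`, and the numbers of successors
satisfying any formula of degree less than `k` have the same scale. -/
structure Agree (k : ℕ) (α β : Ordinal.{u}) (M : KripkeModel.{u, v} P) (s : M.World)
    (N : KripkeModel.{u, v} P) (w : N.World) : Prop where
  holds : ∀ φ : Formula P, φ.deg ≤ k → (M.Holds φ s ↔ N.Holds φ w)
  scale_count : ∀ φ : Formula P, φ.deg < k →
    scale α (count (M.succs s) (M.Holds φ)) = scale β (count (N.succs w) (N.Holds φ))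
  scale_succs : 0 < k → scale α #(M.succs s) = scale β #(N.succs w)

theorem Agree.trans {k : ℕ} {α β γ : Ordinal.{u}} {M N K : KripkeModel.{u, v} P} {s : M.World}
    {w : N.World} {x : K.World} (h : Agree k α β M s N w) (h' : Agree k β γ N w K x) :
    Agree k α γ M s K x where
  holds φ hφ := (h.holds φ hφ).trans (h'.holds φ hφ)
  scale_count φ hφ := (h.scale_count φ hφ).trans (h'.scale_count φ hφ)
  scale_succs hk := (h.scale_succs hk).trans (h'.scale_succs hk)

theorem holds_congr {k : ℕ} {M N : KripkeModel.{u, v} P} {s : M.World} {w : N.World}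
    (hatom : ∀ p, s ∈ M.V p ↔ w ∈ N.V p)
    (hbox : ∀ φ : Formula P, φ.deg < k → (M.Holds (.box φ) s ↔ N.Holds (.box φ) w))
    (hboxbox : ∀ φ : Formula P, φ.deg + 1 < k → (M.Holds (.boxbox φ) s ↔ N.Holds (.boxbox φ) w))
    (φ : Formula P) (hφ : φ.deg ≤ k) : M.Holds φ s ↔ N.Holds φ w := by
  induction φ with
  | atom p => exact hatom p
  | neg φ ih => exact not_congr (ih hφ)
  | and φ ψ ihφ ihψ => exact and_congr (ihφ (le_of_max_le_left hφ)) (ihψ (le_of_max_le_right hφ))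
  | box φ => exact hbox φ hφ
  | boxbox φ => exact hboxbox φ hφ

theorem finite_setOf_determined {X : Type u} {G : Set (X → Prop)} (hG : G.Finite) :
    {Q : X → Prop | ∀ x y, (∀ q ∈ G, q x ↔ q y) → (Q x ↔ Q y)}.Finite := by
  have := hG.to_subtype
  let theory (x : X) : Set G := {q | q.1 x}
  refine (Set.finite_range fun (B : Set (Set G)) x => theory x ∈ B).subset fun Q hQ =>
    ⟨theory '' {x | Q x}, funext fun y => propext ⟨?_, fun hy => ⟨y, hy, rfl⟩⟩⟩
  rintro ⟨x, hx, hxy⟩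
  exact (hQ x y fun q hq => Set.ext_iff.1 hxy ⟨q, hq⟩).1 hx

theorem finite_setOf_holds [Finite P] (M : KripkeModel.{u, v} P) (k : ℕ) :
    {Q : M.World → Prop | ∃ φ : Formula P, φ.deg < k ∧ M.Holds φ = Q}.Finite := by
  induction k with
  | zero => simp only [not_lt_zero, false_and, exists_false, Set.ofPred_false, Set.finite_empty]
  | succ k ih =>
    have hG := (Set.finite_range fun (p : P) x => x ∈ M.V p).union
      ((ih.image fun Q s => Majority (M.succs s) Q).union (ih.image fun Q s => M.GrandMajority s Q))
    refine (finite_setOf_determined hG).subset ?_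
    rintro _ ⟨φ, hφ, rfl⟩ x y hxy
    refine holds_congr (k := k) (fun p => hxy _ (.inl ⟨p, rfl⟩)) (fun ψ hψ => ?_)
      (fun ψ hψ => ?_) φ (by lia)
    · exact hxy _ (.inr (.inl ⟨_, ⟨ψ, hψ, rfl⟩, rfl⟩))
    · exact hxy _ (.inr (.inr ⟨_, ⟨ψ, by lia, rfl⟩, rfl⟩))

theorem exists_finite_types [Finite P] (M : KripkeModel.{u, v} P) (S : Set M.World) (k : ℕ)
    (α : Ordinal.{u}) : ∃ (T : Type u) (_ : Finite T) (type : S → T), type.Surjective ∧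
      ∀ t t', type t = type t' → Agree k α α M t M t' := by
  let F : Set (M.World → Prop) := {Q | ∃ φ : Formula P, φ.deg < k + 1 ∧ M.Holds φ = Q}
  have : Finite F := (M.finite_setOf_holds (k + 1)).to_subtype
  let type (t : S) : (F → Prop) × (F → Prop × Prop × Prop) × (Prop × Prop × Prop) :=
    (fun Q => Q.1 t, fun Q => scale α (count (M.succs t) Q.1), scale α #(M.succs t))
  refine ⟨Set.range type, inferInstance, Set.rangeFactorization type,
    Set.rangeFactorization_surjective, fun t t' htt' => ?_⟩
  simp only [Set.rangeFactorization, Subtype.mk.injEq, type, Prod.mk.injEq] at htt'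
  obtain ⟨hholds, hcount, hsuccs⟩ := htt'
  exact ⟨fun φ hφ => iff_of_eq (congrFun hholds ⟨_, φ, by lia, rfl⟩),
    fun φ hφ => congrFun hcount ⟨_, φ, by lia, rfl⟩, fun _ => hsuccs⟩

end KripkeModel

open KripkeModel

theorem KripkeModel.mk_grandSuccs_le {P : Type v} {M : KripkeModel.{u, v} P}
    (hR : Relator.LeftUnique M.R) {s : M.World} {c : Cardinal.{u}} (hc : ℵ₀ ≤ c)
    (hlive : #(M.liveSuccs s) ≤ c) (hsuccs : ∀ t : M.succs s, #(M.succs t) ≤ c) :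
    #(M.grandSuccs s) ≤ c :=
  calc #(M.grandSuccs s) ≤ Cardinal.sum fun _ : M.liveSuccs s => c :=
        (mk_grandSuccs hR s).trans_le (Cardinal.sum_le_sum _ _ fun t => hsuccs ⟨t, t.2.1⟩)
    _ = #(M.liveSuccs s) * c := by rw [Cardinal.sum_const, Cardinal.lift_id, Cardinal.lift_id]
    _ ≤ c := Cardinal.mul_le_of_le hc hlive le_rfl

namespace IsCollapse

variable {P : Type v} {M N : KripkeModel.{u, v} P} {s : M.World} {w : N.World}
  {A : Finset Cardinal.{u}} {m : ℕ} {T : Type u} {type : M.succs s → T}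
  {type' : N.succs w → T} {Q : M.World → Prop} {Q' : N.World → Prop} {ζ ζ' : Ordinal.{u}}

theorem count_mem (h : IsCollapse A m type type') (hQ : ∀ t x, type t = type' x → (Q t ↔ Q' x)) :
    count (M.succs s) Q ∈ A :=
  count_eq_mk_subtype (M.succs s) Q ▸ h.mk_subtype_mem hQ

variable [Finite T]

theorem count_eq_collapse (h : IsCollapse A m type type')
    (hQ : ∀ t x, type t = type' x → (Q t ↔ Q' x)) :
    count (N.succs w) Q' = collapse A m (count (M.succs s) Q) := by
  rw [count_eq_mk_subtype, count_eq_mk_subtype, h.mk_subtype_eq hQ]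

theorem mk_succs_eq_collapse (h : IsCollapse A m type type') :
    #(N.succs w) = collapse A m #(M.succs s) := by
  rw [← count_true, ← count_true, h.count_eq_collapse (Q := fun _ => True) fun _ _ _ => Iff.rfl]

theorem scale_count (h : IsCollapse A m type type') (hζ : collapse A m (ℵ_ ζ) = ℵ_ ζ')
    (hQ : ∀ t x, type t = type' x → (Q t ↔ Q' x)) :
    scale ζ (count (M.succs s) Q) = scale ζ' (count (N.succs w) Q') :=
  h.count_eq_collapse hQ ▸ scale_collapse (h.count_mem hQ) hζ

theorem exists_succ_iff (h : IsCollapse A m type type')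
    (hQ : ∀ t x, type t = type' x → (Q t ↔ Q' x)) :
    (∃ t ∈ M.succs s, Q t) ↔ ∃ x ∈ N.succs w, Q' x := by
  rw [← count_ne_zero, ← count_ne_zero, h.count_eq_collapse hQ, ne_eq, ne_eq, collapse_eq_zero]

theorem majority_iff (h : IsCollapse A m type type')
    (hQ : ∀ t x, type t = type' x → (Q t ↔ Q' x)) :
    Majority (M.succs s) Q ↔ Majority (N.succs w) Q' := by
  have hQ_not : ∀ t x, type t = type' x → (¬ Q t ↔ ¬ Q' x) := fun t x htx => not_congr (hQ t x htx)
  have hall : (∀ t ∈ M.succs s, Q t) ↔ ∀ x ∈ N.succs w, Q' x := by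
    simpa only [not_exists, not_and, not_not] using
      not_congr (h.exists_succ_iff (Q := fun t => ¬ Q t) (Q' := fun x => ¬ Q' x) hQ_not)
  rw [Majority, Majority, h.mk_succs_eq_collapse, h.count_eq_collapse hQ,
    h.count_eq_collapse (Q := fun t => ¬ Q t) hQ_not, aleph0_le_collapse, collapse_lt_aleph0,
    collapse_lt_iff (h.count_mem (Q := fun t => ¬ Q t) (Q' := fun x => ¬ Q' x) hQ_not), hall]

theorem exists_grandSucc_iff (h : IsCollapse A m type type')
    (hQ : ∀ t x, type t = type' x → ((∃ y ∈ M.succs t, Q y) ↔ ∃ z ∈ N.succs x, Q' z)) :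
    (∃ y ∈ M.grandSuccs s, Q y) ↔ ∃ z ∈ N.grandSuccs w, Q' z := by
  have exists_grandSuccs {K : KripkeModel.{u, v} P} (r : K.World) (q : K.World → Prop) :
      (∃ y ∈ K.grandSuccs r, q y) ↔ ∃ t ∈ K.succs r, ∃ y ∈ K.succs t, q y :=
    ⟨fun ⟨y, ⟨t, ht, hy⟩, hq⟩ => ⟨t, ht, y, hy, hq⟩, fun ⟨t, ht, y, hy, hq⟩ => ⟨y, ⟨t, ht, hy⟩, hq⟩⟩
  rw [exists_grandSuccs, exists_grandSuccs]
  exact h.exists_succ_iff hQ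

section LeftUnique

variable (hM : Relator.LeftUnique M.R) (hN : Relator.LeftUnique N.R)

include hM hN

theorem le_count_grandSuccs_iff (h : IsCollapse A m type type') {c d : Cardinal.{u}}
    (hc : c.IsRegular) (hd : d.IsRegular) (hcd : ∀ b ∈ A, c ≤ b ↔ d ≤ collapse A m b)
    (hle : ∀ t x, type t = type' x → (c ≤ count (M.succs t) Q ↔ d ≤ count (N.succs x) Q'))
    (hQ : ∀ t x, type t = type' x → ((∃ y ∈ M.succs t, Q y) ↔ ∃ z ∈ N.succs x, Q' z)) :
    c ≤ count (M.grandSuccs s) Q ↔ d ≤ count (N.grandSuccs w) Q' := by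
  rw [KripkeModel.le_count_grandSuccs_iff hM hc, KripkeModel.le_count_grandSuccs_iff hN hd]
  refine or_congr (h.exists_succ_iff hle) ?_
  rw [h.count_eq_collapse (Q := fun t => ∃ y ∈ M.succs t, Q y) hQ]
  exact hcd _ (h.count_mem (Q' := fun x => ∃ z ∈ N.succs x, Q' z) hQ)

variable (h : IsCollapse A m type type') (hreg : (ℵ_ ζ).IsRegular) (hreg' : (ℵ_ ζ').IsRegular)
  (hζ : collapse A m (ℵ_ ζ) = ℵ_ ζ')

include h hreg hreg' hζ

theorem scale_count_grandSuccs (hscale : ∀ t x, type t = type' x →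
      scale ζ (count (M.succs t) Q) = scale ζ' (count (N.succs x) Q')) :
    scale ζ (count (M.grandSuccs s) Q) = scale ζ' (count (N.grandSuccs w) Q') := by
  simp only [scale_eq_scale_iff, ← not_le (a := ℵ₀), not_iff_not] at hscale ⊢
  have hQ : ∀ t x, type t = type' x → ((∃ y ∈ M.succs t, Q y) ↔ ∃ z ∈ N.succs x, Q' z) :=
    fun t x htx => by simpa only [count_ne_zero] using not_congr (hscale t x htx).1
  refine ⟨?_, ?_, ?_⟩
  · simpa only [← count_ne_zero, ne_eq, not_iff_not] using h.exists_grandSucc_iff hQ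
  · exact h.le_count_grandSuccs_iff hM hN isRegular_aleph0 isRegular_aleph0
      (fun _ _ => aleph0_le_collapse.symm) (fun t x htx => (hscale t x htx).2.1) hQ
  · exact h.le_count_grandSuccs_iff hM hN hreg hreg'
      (fun _ hb => by rw [← hζ, collapse_le_iff hb]) (fun t x htx => (hscale t x htx).2.2) hQ

theorem scale_mk_grandSuccs
    (hscale : ∀ t x, type t = type' x → scale ζ #(M.succs t) = scale ζ' #(N.succs x)) :
    scale ζ #(M.grandSuccs s) = scale ζ' #(N.grandSuccs w) := by
  simpa only [count_true] using h.scale_count_grandSuccs hM hN (Q := fun _ => True)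
    (Q' := fun _ => True) hreg hreg' hζ (by simpa only [count_true] using hscale)

theorem mk_grandSuccs_eq
    (hscale : ∀ t x, type t = type' x → scale ζ #(M.succs t) = scale ζ' #(N.succs x))
    (hle : ∀ x : N.succs w, #(N.succs x) ≤ ℵ_ ζ') (hgrand : #(M.grandSuccs s) = ℵ_ ζ) :
    #(N.grandSuccs w) = ℵ_ ζ' := by
  refine (mk_grandSuccs_le hN (aleph0_le_aleph ζ') ?_ hle).antisymm ?_
  · have hlive : #(N.liveSuccs w) = collapse A m #(M.liveSuccs s) :=
      h.count_eq_collapse (Q := fun t => ∃ y, M.R t y) (Q' := fun x => ∃ z, N.R x z)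
        fun t x htx => by
          have hzero := not_congr (scale_eq_scale_iff.1 (hscale t x htx)).1
          rwa [← ne_eq, ← ne_eq, Cardinal.mk_ne_zero_iff, Cardinal.mk_ne_zero_iff,
            Set.nonempty_coe_sort, Set.nonempty_coe_sort] at hzero
    rw [hlive, ← hζ, ← hgrand]
    exact collapse_mono (mk_liveSuccs_le_mk_grandSuccs hM s)
  · exact (scale_eq_scale_iff.1 (h.scale_mk_grandSuccs hM hN hreg hreg' hζ hscale)).2.2.1 hgrand.ge

theorem reaches_iff (hscale : ∀ t x, type t = type' x →
      scale ζ (count (M.succs t) Q) = scale ζ' (count (N.succs x) Q')) :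
    ∀ i, M.Reaches (ℵ_ ζ) s Q i ↔ N.Reaches (ℵ_ ζ') w Q' i := by
  obtain ⟨hzero, -, haleph⟩ :=
    scale_eq_scale_iff.1 (h.scale_count_grandSuccs hM hN hreg hreg' hζ hscale)
  rintro (_ | _ | _ | i)
  · simpa only [Reaches, ← ne_eq, count_ne_zero] using not_congr hzero
  · exact haleph
  · exact (scale_eq_scale_iff.1 (h.scale_count hζ fun t x htx =>
      (scale_eq_scale_iff.1 (hscale t x htx)).2.2)).2.2
  · exact Iff.rfl

theorem grandMajority_iff (hle : ∀ x : N.succs w, #(N.succs x) ≤ ℵ_ ζ')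
    (hgrand : ℵ₀ ≤ #(M.grandSuccs s) → #(M.grandSuccs s) = ℵ_ ζ)
    (hscale_succs : ∀ t x, type t = type' x → scale ζ #(M.succs t) = scale ζ' #(N.succs x))
    (hscale : ∀ t x, type t = type' x →
      scale ζ (count (M.succs t) Q) = scale ζ' (count (N.succs x) Q'))
    (hscale_not : ∀ t x, type t = type' x →
      scale ζ (count (M.succs t) fun y => ¬ Q y) = scale ζ' (count (N.succs x) fun z => ¬ Q' z)) :
    M.GrandMajority s Q ↔ N.GrandMajority w Q' := by
  have hfinite :=
    (scale_eq_scale_iff.1 (h.scale_mk_grandSuccs hM hN hreg hreg' hζ hscale_succs)).2.1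
  rcases lt_or_ge #(M.grandSuccs s) ℵ₀ with hlt | hinf
  · have hnot := (scale_eq_scale_iff.1
      (h.scale_count_grandSuccs hM hN hreg hreg' hζ hscale_not)).1
    simpa only [GrandMajority, hlt, hlt.not_ge, hfinite.1 hlt, (hfinite.1 hlt).not_ge, false_and,
      true_and, false_or, count_eq_zero, not_not] using hnot
  · have hinf' : ℵ₀ ≤ #(N.grandSuccs w) := not_lt.1 (mt hfinite.2 hinf.not_gt)
    have hM_grand := hgrand hinf
    have hN_grand := h.mk_grandSuccs_eq hM hN hreg hreg' hζ hscale_succs hle hM_grand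
    simp only [GrandMajority, hinf, hinf', hinf.not_gt, hinf'.not_gt, true_and, false_and, or_false]
    rw [hM_grand, hN_grand]
    simp only [h.reaches_iff hM hN hreg hreg' hζ hscale,
      h.reaches_iff hM hN hreg hreg' hζ hscale_not]

theorem agree {k : ℕ} {α β : Ordinal.{u}} (hα : collapse A m (ℵ_ α) = ℵ_ β)
    (hV : ∀ p, s ∈ M.V p ↔ w ∈ N.V p)
    (hle : ∀ x : N.succs w, #(N.succs x) ≤ ℵ_ ζ')
    (hgrand : ℵ₀ ≤ #(M.grandSuccs s) → #(M.grandSuccs s) = ℵ_ ζ)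
    (hagree : ∀ t x, type t = type' x → Agree k ζ ζ' M t N x) :
    Agree (k + 1) α β M s N w where
  holds := holds_congr hV
    (fun φ hφ => h.majority_iff fun t x htx => (hagree t x htx).holds φ (by lia))
    fun φ hφ => h.grandMajority_iff hM hN hreg hreg' hζ hle hgrand
      (fun t x htx => (hagree t x htx).scale_succs (by lia))
      (fun t x htx => (hagree t x htx).scale_count φ (by lia))
      fun t x htx => (hagree t x htx).scale_count (.neg φ) (Nat.lt_of_succ_lt_succ hφ)
  scale_count φ hφ := h.scale_count hα fun t x htx => (hagree t x htx).holds φ (by lia)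
  scale_succs _ := by
    simpa only [count_true] using
      h.scale_count hα (Q := fun _ => True) (Q' := fun _ => True) fun _ _ _ => Iff.rfl

end LeftUnique

end IsCollapse

/-! ### Joins of pointed models -/

theorem count_image {X Y : Type u} {g : X → Y} (hg : g.Injective) (A : Set X) (Q : Y → Prop) :
    count (g '' A) Q = count A fun x => Q (g x) := by
  have himage : {y | y ∈ g '' A ∧ Q y} = g '' {x | x ∈ A ∧ Q (g x)} := by
    ext y
    exact ⟨fun ⟨⟨x, hx, hxy⟩, hQ⟩ => ⟨x, ⟨hx, hxy ▸ hQ⟩, hxy⟩,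
      fun ⟨x, ⟨hx, hQ⟩, hxy⟩ => ⟨⟨x, hx, hxy⟩, hxy ▸ hQ⟩⟩
  exact (congrArg (fun S : Set Y => #S) himage).trans (Cardinal.mk_image_eq hg)

namespace KripkeModel

variable {P : Type v}

/-- `g` embeds `M` into `N` as a submodel which is closed under successors. -/
structure IsGeneratedEmbedding {M N : KripkeModel.{u, v} P} (g : M.World → N.World) : Prop where
  injective : g.Injective
  succs_eq : ∀ x, N.succs (g x) = g '' M.succs x
  val_iff : ∀ p x, g x ∈ N.V p ↔ x ∈ M.V p

namespace IsGeneratedEmbedding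

variable {M N : KripkeModel.{u, v} P} {g : M.World → N.World}

theorem mk_succs (hg : IsGeneratedEmbedding g) (x : M.World) :
    #(N.succs (g x)) = #(M.succs x) := by
  rw [hg.succs_eq, Cardinal.mk_image_eq hg.injective]

theorem count_succs (hg : IsGeneratedEmbedding g) (x : M.World) (Q : N.World → Prop) :
    count (N.succs (g x)) Q = count (M.succs x) fun y => Q (g y) := by
  rw [hg.succs_eq, count_image hg.injective]

theorem grandSuccs_eq (hg : IsGeneratedEmbedding g) (x : M.World) :
    N.grandSuccs (g x) = g '' M.grandSuccs x := by
  have rel_iff (x : M.World) (y : N.World) : N.R (g x) y ↔ ∃ z, M.R x z ∧ g z = y :=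
    Set.ext_iff.1 (hg.succs_eq x) y
  ext y
  constructor
  · rintro ⟨_, hgt, hty⟩
    obtain ⟨t, ht, rfl⟩ := (rel_iff x _).1 hgt
    obtain ⟨z, hz, rfl⟩ := (rel_iff t y).1 hty
    exact ⟨z, ⟨t, ht, hz⟩, rfl⟩
  · rintro ⟨z, ⟨t, ht, hz⟩, rfl⟩
    exact ⟨g t, (rel_iff x _).2 ⟨t, ht, rfl⟩, (rel_iff t _).2 ⟨z, hz, rfl⟩⟩

theorem reaches_iff (hg : IsGeneratedEmbedding g) (c : Cardinal.{u}) (x : M.World)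
    (Q : N.World → Prop) (i : ℕ) :
    N.Reaches c (g x) Q i ↔ M.Reaches c x (fun y => Q (g y)) i := by
  rcases i with _ | _ | _ | i
  · simp only [Reaches, hg.grandSuccs_eq, Set.exists_mem_image]
  · simp only [Reaches, hg.grandSuccs_eq, count_image hg.injective]
  · simp only [Reaches, hg.count_succs]
  · exact Iff.rfl

theorem holds_iff (hg : IsGeneratedEmbedding g) (φ : Formula P) (x : M.World) :
    N.Holds φ (g x) ↔ M.Holds φ x := by
  induction φ generalizing x with
  | atom p => exact hg.val_iff p x
  | neg φ ih => exact not_congr (ih x)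
  | and φ ψ ihφ ihψ => exact and_congr (ihφ x) (ihψ x)
  | box φ ih =>
    simp only [Holds, Majority, hg.succs_eq, Cardinal.mk_image_eq hg.injective,
      count_image hg.injective, Set.forall_mem_image, ih]
  | boxbox φ ih =>
    simp only [Holds, GrandMajority, hg.reaches_iff, hg.grandSuccs_eq,
      Cardinal.mk_image_eq hg.injective, Set.forall_mem_image, ih]

theorem agree (hg : IsGeneratedEmbedding g) (k : ℕ) (α : Ordinal.{u}) (x : M.World) :
    Agree k α α M x N (g x) where
  holds φ _ := (hg.holds_iff φ x).symm
  scale_count φ _ := by simp only [hg.count_succs, hg.holds_iff]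
  scale_succs _ := by rw [hg.mk_succs]

end IsGeneratedEmbedding

/-- The join of a family of pointed models: the roots `w i` become the successors of a new root
`none`, at which exactly the propositions in `V₀` are true. -/
def join (V₀ : Set P) {I : Type u} (K : I → KripkeModel.{u, v} P) (w : ∀ i, (K i).World) :
    KripkeModel.{u, v} P where
  World := Option (Σ i, (K i).World)
  nonempty := ⟨none⟩
  R x y := y.elim False fun z =>
    (x = none ∧ z.2 = w z.1) ∨ ∃ x', x = some ⟨z.1, x'⟩ ∧ (K z.1).R x' z.2
  V p := {x | x.elim (p ∈ V₀) fun y => y.2 ∈ (K y.1).V p}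

section Join

variable {V₀ : Set P} {I : Type u} {K : I → KripkeModel.{u, v} P} {w : ∀ i, (K i).World}

theorem join_succs_none : (join V₀ K w).succs none = Set.range fun i => some ⟨i, w i⟩ := by
  ext y
  constructor
  · rcases y with _ | ⟨i, y⟩
    · exact False.elim
    · rintro (⟨-, rfl : y = w i⟩ | ⟨x, hx, -⟩)
      · exact ⟨i, rfl⟩
      · cases hx
  · rintro ⟨i, rfl⟩
    exact .inl ⟨rfl, rfl⟩

theorem isGeneratedEmbedding_join (V₀ : Set P) (K : I → KripkeModel.{u, v} P)
    (w : ∀ i, (K i).World) (i : I) :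
    IsGeneratedEmbedding (M := K i) (N := join V₀ K w) fun x => some ⟨i, x⟩ where
  injective := (Option.some_injective _).comp sigma_mk_injective
  succs_eq x := by
    ext y
    constructor
    · rcases y with _ | ⟨j, y⟩
      · exact False.elim
      · rintro (⟨hx, -⟩ | ⟨x', hx, hR⟩)
        · cases hx
        · cases hx
          exact ⟨y, hR, rfl⟩
    · rintro ⟨y, hR, rfl⟩
      exact .inr ⟨x, rfl, hR⟩
  val_iff _ _ := Iff.rfl

theorem join_isTreeLike (h : ∀ i, (K i).IsTreeLike (w i)) : (join V₀ K w).IsTreeLike none where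
  reachable := by
    rintro (_ | ⟨i, x⟩)
    · exact .refl
    · have hroot : (join V₀ K w).R none (some ⟨i, w i⟩) := Or.inl ⟨rfl, rfl⟩
      have hlift : Relation.ReflTransGen (join V₀ K w).R (some ⟨i, w i⟩) (some ⟨i, x⟩) :=
        ((h i).reachable x).lift (fun x => (some ⟨i, x⟩ : (join V₀ K w).World))
          fun _ _ hR => .inr ⟨_, rfl, hR⟩
      exact hlift.head hroot
  root := by
    rintro x ⟨⟩
  unique_pred := by
    rintro x y (_ | ⟨i, z⟩)
    · exact False.elim
    rintro (⟨rfl, hz : z = w i⟩ | ⟨x, rfl, hx⟩) (⟨rfl, hz' : z = w i⟩ | ⟨y, rfl, hy⟩)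
    · rfl
    · exact ((h i).root y (hz ▸ hy)).elim
    · exact ((h i).root x (hz' ▸ hx)).elim
    · rw [(h i).unique_pred x y z hx hy]

end Join

end KripkeModel

theorem sum_lt_of_finite {T : Type u} [Finite T] {c : Cardinal.{u}} (hc : ℵ₀ ≤ c)
    {f : T → Cardinal.{u}} (h : ∀ τ, f τ < c) : Cardinal.sum f < c := by
  have hT : #T < ℵ₀ := Cardinal.lt_aleph0_of_finite T
  refine (Cardinal.sum_le_mk_mul_iSup f).trans_lt (Cardinal.mul_lt_of_lt hc (hT.trans_le hc) ?_)
  rcases isEmpty_or_nonempty T with _ | _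
  · rw [ciSup_of_empty]
    exact aleph0_pos.trans_le hc
  · obtain ⟨τ, hτ⟩ := exists_eq_ciSup_of_finite (f := f)
    exact hτ ▸ h τ

namespace KripkeModel

variable {P : Type v}

theorem exists_bouquet {T : Type u} [Finite T] (V₀ : Set P) {K : T → KripkeModel.{u, v} P}
    {w : ∀ τ, (K τ).World} (htree : ∀ τ, (K τ).IsTreeLike (w τ))
    (hK : ∀ τ, #(K τ).World < ℵ_ ω) {μ : T → Cardinal.{u}} (hμ : ∀ τ, μ τ < ℵ_ ω) :
    ∃ (N : KripkeModel.{u, v} P) (r : N.World) (type : N.succs r → T),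
      N.IsTreeLike r ∧ #N.World < ℵ_ ω ∧ (∀ p, r ∈ N.V p ↔ p ∈ V₀) ∧
      (∀ τ, #(type ⁻¹' {τ}) = μ τ) ∧
      ∀ x, ∃ g : (K (type x)).World → N.World, IsGeneratedEmbedding g ∧ g (w (type x)) = x := by
  let I := Σ τ, (μ τ).out
  let N := join V₀ (fun i : I => K i.1) fun i => w i.1
  have hroot_inj : Function.Injective fun i : I => (some ⟨i, w i.1⟩ : N.World) :=
    fun i j hij => congrArg Sigma.fst (Option.some_injective _ hij)
  let succEquiv : I ≃ N.succs none :=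
    (Equiv.ofInjective _ hroot_inj).trans (Equiv.setCongr join_succs_none.symm)
  refine ⟨N, none, fun x => (succEquiv.symm x).1, join_isTreeLike fun i => htree i.1, ?_,
    fun _ => Iff.rfl, fun τ => ?_, fun x => ⟨fun y => some ⟨succEquiv.symm x, y⟩,
      isGeneratedEmbedding_join V₀ (fun i : I => K i.1) (fun i => w i.1) (succEquiv.symm x), ?_⟩⟩
  · have hinf : ℵ₀ ≤ ℵ_ ω := aleph0_le_aleph ω
    have hworld : #N.World = Cardinal.sum (fun τ => μ τ * #(K τ).World) + 1 := by
      refine Cardinal.mk_option.trans (congrArg (· + 1) ?_)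
      rw [(Equiv.sigmaAssoc fun τ (_ : (μ τ).out) => (K τ).World).cardinal_eq, Cardinal.mk_sigma]
      simp only [Cardinal.mk_sigma, Cardinal.sum_const, Cardinal.lift_id, Cardinal.mk_out]
    rw [hworld]
    exact Cardinal.add_lt_of_lt hinf
      (sum_lt_of_finite hinf fun τ => Cardinal.mul_lt_of_lt hinf (hμ τ) (hK τ))
      (one_lt_aleph0.trans_le hinf)
  · calc #((fun x => (succEquiv.symm x).1) ⁻¹' {τ}) = #{i : I // i.1 = τ} :=
          Cardinal.mk_congr (succEquiv.symm.subtypeEquiv fun _ => Iff.rfl)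
      _ = μ τ := by rw [(Equiv.sigmaSubtype τ).cardinal_eq, Cardinal.mk_out]
  · exact congrArg Subtype.val (succEquiv.apply_symm_apply x)

end KripkeModel

/-! ### Small copies -/

theorem isRegular_aleph_natCast (n : ℕ) : (ℵ_ (n : Ordinal.{u})).IsRegular := by
  cases n with
  | zero => rw [Nat.cast_zero, aleph_zero]; exact isRegular_aleph0
  | succ n => rw [Nat.cast_succ]; exact isRegular_aleph_add_one n

theorem log_omega_ord {α : Ordinal.{u}} {c : Cardinal.{u}} (hc : c ≤ ℵ_ α) [Decidable (ℵ_ α ≤ c)] :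
    Ordinal.log (ω_ α) c.ord = if ℵ_ α ≤ c then 1 else 0 := by
  split_ifs with hαc
  · rw [hc.antisymm hαc, ord_aleph]
    simpa only [opow_one] using Ordinal.log_opow (one_lt_omega α) 1
  · exact Ordinal.log_eq_zero (ord_aleph α ▸ Cardinal.ord_lt_ord.2 (not_le.1 hαc))

theorem log_eq_log_of_scale_eq {α β : Ordinal.{u}} {c d : Cardinal.{u}} (hc : c ≤ ℵ_ α)
    (hd : d ≤ ℵ_ β) (h : scale α c = scale β d) :
    Ordinal.log (ω_ α) c.ord = Ordinal.log (ω_ β) d.ord := by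
  classical
  rw [log_omega_ord hc, log_omega_ord hd]
  simp only [(scale_eq_scale_iff.1 h).2.2]

namespace KripkeModel

variable {P : Type v}

theorem hasRegularCards_of_lt {N : KripkeModel.{u, v} P} (h : #N.World < ℵ_ ω) :
    N.HasRegularCards := by
  intro x hx
  obtain ⟨ζ, hζ⟩ := mem_range_aleph_iff.2 hx
  have hlt : ℵ_ ζ < ℵ_ ω := hζ ▸ (Cardinal.mk_set_le _).trans_lt h
  obtain ⟨n, rfl⟩ := lt_omega0.1 (aleph_lt_aleph.1 hlt)
  exact hζ ▸ isRegular_aleph_natCast n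

theorem IsTreeLike.leftUnique {M : KripkeModel.{u, v} P} {s : M.World} (h : M.IsTreeLike s) :
    Relator.LeftUnique M.R :=
  fun x y z => h.unique_pred x y z

theorem Agree.modalEquiv {k : ℕ} {α β : Ordinal.{u}} {M N : KripkeModel.{u, v} P} {s : M.World}
    {w : N.World} (h : Agree k α β M s N w) (hM : Relator.LeftUnique M.R)
    (hN : Relator.LeftUnique N.R) (hregM : M.HasRegularCards) (hregN : N.HasRegularCards)
    (hα : #(M.succs s) ≤ ℵ_ α) (hβ : #(N.succs w) ≤ ℵ_ β) (e : M.Enumeration)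
    (e' : N.Enumeration) : ModalEquiv k α β M e s N e' w := by
  simp only [ModalEquiv, sat_iff_holds hM hregM, sat_iff_holds hN hregN]
  refine ⟨h.holds, fun φ hφ => ?_⟩
  have hscale := h.scale_count φ hφ
  have hempty : (∃ t, M.R s t ∧ M.Holds φ t) ↔ ∃ x, N.R w x ∧ N.Holds φ x :=
    count_ne_zero.symm.trans ((not_congr (scale_eq_scale_iff.1 hscale).1).trans count_ne_zero)
  rw [← hempty, and_self, ← and_assoc, and_self]
  exact (em' _).imp_right fun hex => ⟨hex, log_eq_log_of_scale_eq
    ((count_le_mk _ _).trans hα) ((count_le_mk _ _).trans hβ) hscale⟩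

/-- `M, s` has a tree-like copy of size less than `ℵ_ ω`, up to degree `k`, for which `ℵ_ n` plays
the role of `ℵ_ α`. -/
def HasSmallCopy (k : ℕ) (α : Ordinal.{u}) (n : ℕ) (M : KripkeModel.{u, v} P) (s : M.World) :
    Prop :=
  ∃ (N : KripkeModel.{u, v} P) (w : N.World), N.IsTreeLike w ∧ #N.World < ℵ_ ω ∧
    #(N.succs w) ≤ ℵ_ (n : Ordinal.{u}) ∧ Agree k α n M s N w

theorem hasSmallCopy_zero (α : Ordinal.{u}) (n : ℕ) (M : KripkeModel.{u, v} P) (s : M.World) :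
    HasSmallCopy 0 α n M s := by
  obtain ⟨N, w, type, htree, hN, hV, -⟩ := exists_bouquet (T := PEmpty) {p | s ∈ M.V p}
    (K := fun τ => τ.elim) (w := fun τ => τ.elim) (fun τ => τ.elim) (fun τ => τ.elim)
    (μ := fun _ => 0) fun τ => τ.elim
  have hsuccs : #(N.succs w) = 0 := Cardinal.mk_eq_zero_iff.2 ⟨fun x => (type x).elim⟩
  exact ⟨N, w, htree, hN, hsuccs ▸ zero_le, {
    holds := holds_congr (fun p => (hV p).symm) (fun _ h => (Nat.not_lt_zero _ h).elim)
      fun _ h => (Nat.not_lt_zero _ h).elim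
    scale_count := fun _ h => (Nat.not_lt_zero _ h).elim
    scale_succs := fun h => h.false.elim }⟩

theorem eventually_hasSmallCopy_succ [Finite P] {M : KripkeModel.{u, v} P}
    (hM : Relator.LeftUnique M.R) {s : M.World} {k : ℕ} {α ζ : Ordinal.{u}}
    (hα : #(M.succs s) ≤ ℵ_ α) (hreg : (ℵ_ ζ).IsRegular)
    (hgrand : ℵ₀ ≤ #(M.grandSuccs s) → #(M.grandSuccs s) = ℵ_ ζ)
    (hsucc : ∀ t : M.succs s, ∀ᶠ n in Filter.atTop, HasSmallCopy k ζ n M t) :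
    ∀ᶠ n in Filter.atTop, HasSmallCopy (k + 1) α n M s := by
  obtain ⟨T, _, type, hsurj, htype⟩ := exists_finite_types M (M.succs s) k ζ
  choose rep hrep using hsurj
  obtain ⟨m, hm⟩ := Filter.eventually_atTop.1 (Filter.eventually_all.2 fun τ => hsucc (rep τ))
  let A : Finset Cardinal.{u} := (Set.finite_range fun B : Set T => #(type ⁻¹' B)).toFinset
  refine Filter.eventually_atTop.2 ⟨m + A.card, fun n hn => ?_⟩
  obtain ⟨n₀, hn₀, hα_collapse⟩ := exists_collapse_aleph_eq_aleph α hn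
  obtain ⟨n', hn', hζ_collapse⟩ := exists_collapse_aleph_eq A n₀ ζ
  choose K w htree hK hsuccs hcopy using hm n' (hn₀.trans hn')
  obtain ⟨N, r, type', hN, hcard, hV, hfiber, hgen⟩ := exists_bouquet {p | s ∈ M.V p} htree hK
    (μ := fun τ => collapse A n₀ #(type ⁻¹' {τ})) fun _ => collapse_lt_aleph_omega
  choose g hg hgx using hgen
  have h : IsCollapse A n₀ type type' := ⟨fun B => (Set.Finite.mem_toFinset _).2 ⟨B, rfl⟩, hfiber⟩
  have hle (x : N.succs r) : #(N.succs x) ≤ ℵ_ (n' : Ordinal.{u}) := by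
    rw [← hgx, (hg x).mk_succs]
    exact hsuccs (type' x)
  have hagree (t x) (htx : type t = type' x) : Agree k ζ n' M t N x :=
    ((htype t _ (htx.trans (hrep _).symm)).trans (hcopy _)).trans (hgx x ▸ (hg x).agree k n' _)
  refine ⟨N, r, hN, hcard, ?_, h.agree hM hN.leftUnique hreg (isRegular_aleph_natCast n')
    hζ_collapse hα_collapse (fun p => (hV p).symm) hle hgrand hagree⟩
  rw [h.mk_succs_eq_collapse, ← hα_collapse]
  exact collapse_mono hα

theorem eventually_hasSmallCopy [Finite P] {M : KripkeModel.{u, v} P}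
    (hM : Relator.LeftUnique M.R) (hreg : M.HasRegularCards) (k : ℕ) (s : M.World)
    (α : Ordinal.{u}) (hα : #(M.succs s) ≤ ℵ_ α) :
    ∀ᶠ n in Filter.atTop, HasSmallCopy k α n M s := by
  induction k generalizing s α with
  | zero => exact .of_forall fun n => hasSmallCopy_zero α n M s
  | succ k ih =>
    obtain ⟨ζ, hζ, hle, hgrand⟩ : ∃ ζ : Ordinal.{u}, (ℵ_ ζ).IsRegular ∧
        #(M.grandSuccs s) ≤ ℵ_ ζ ∧ (ℵ₀ ≤ #(M.grandSuccs s) → #(M.grandSuccs s) = ℵ_ ζ) := by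
      rcases lt_or_ge #(M.grandSuccs s) ℵ₀ with hlt | hinf
      · refine ⟨0, ?_, ?_, fun hinf => (hinf.not_gt hlt).elim⟩ <;> rw [aleph_zero]
        exacts [isRegular_aleph0, hlt.le]
      · obtain ⟨ζ, hζ⟩ := mem_range_aleph_iff.2 hinf
        exact ⟨ζ, hζ ▸ hreg s hinf, hζ.ge, fun _ => hζ.symm⟩
    exact eventually_hasSmallCopy_succ hM hα hζ hgrand fun t =>
      ih t ζ ((mk_succs_le_mk_grandSuccs t.2).trans hle)

end KripkeModel

end TransfiniteModal

open TransfiniteModal KripkeModel in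
theorem mainTheorem2_general {P : Type v} [Finite P] (M : KripkeModel.{u, v} P) (s : M.World)
    (hM : Relator.LeftUnique M.R) (hreg : M.HasRegularCards)
    (k : ℕ) (α : Ordinal.{u}) (hα : #(M.succs s) ≤ ℵ_ α) :
    ∃ m : ℕ, ∀ n : ℕ, m ≤ n →
      ∃ (N : KripkeModel.{u, v} P) (w : N.World),
        N.IsTreeLike w ∧ #N.World < ℵ_ ω ∧
        ∀ (e : M.Enumeration) (e' : N.Enumeration),
          ModalEquiv k α (n : Ordinal.{u}) M e s N e' w := by
  obtain ⟨m, hm⟩ := Filter.eventually_atTop.1 (eventually_hasSmallCopy hM hreg k s α hα)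
  refine ⟨m, fun n hn => ?_⟩
  obtain ⟨N, w, htree, hcard, hsuccs, hagree⟩ := hm n hn
  exact ⟨N, w, htree, hcard, hagree.modalEquiv hM htree.leftUnique hreg
    (hasRegularCards_of_lt hcard) hα hsuccs⟩

theorem mainTheorem2 {P : Type v} [Finite P]
    (M : TransfiniteModal.KripkeModel.{u, v} P) (s : M.World)
    (htree : M.IsTreeLike s) (hreg : M.HasRegularCards)
    (k : ℕ) (α : Ordinal.{u}) (hα : #(M.succs s) ≤ ℵ_ α) :
    ∃ m : ℕ, ∀ n : ℕ, m ≤ n →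
      ∃ (N : TransfiniteModal.KripkeModel.{u, v} P) (w : N.World),
        N.IsTreeLike w ∧ #N.World < ℵ_ ω ∧
        ∀ (e : M.Enumeration) (e' : N.Enumeration),
          TransfiniteModal.KripkeModel.ModalEquiv k α (n : Ordinal.{u}) M e s N e' w :=
  mainTheorem2_general M s htree.leftUnique hreg k α hα
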